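/- Let $(\varepsilon_i)_{i\in\mathbb Z}$ be independent and identically distributed real random variables whose common distribution has a density $f$, and let $(\theta_k)_{k\in\mathbb Z}$ be nonnegative real weights such that $\theta_k\neq 0$ for at least one but only finitely many $k$. Put $$X_i=\sum_{k}\theta_k\,\varepsilon_{i+k},\qquad i\in\mathbb Z,$$ and let $0<\gamma<1$. (i) Suppose that, for some constant $C>0$, $f(x)=\exp\{o(x^\gamma)\}\exp(-Cx^\gamma)$ as $x\to\infty$, and that the largest value of $\theta_k$ is attained for a unique index $k$. Then, for each integer $i_0\ge 1$, $$P\bigl(X_i>x\text{ for some } i \text{ with } 1\le |i|\le i_0 \,\big|\, X_0>x\bigr)\to 0\quad\text{as } x\to\infty .$$ (ii) Suppose that, for some constants $C,C_1>0$ and $C_2\ge 0$, $f(x)\sim C_1x^{C_2}\exp(-Cx^\gamma)$ as $x\to\infty$, and that the largest value of $\theta_k$ is attained for exactly $q\ge 2$ indices $k$. Let $r$ be any integer that is not less than the difference between the largest and the least values of $k$ for which $\theta_k\neq 0$, and for $x\in\mathbb R$ let $M=M(x)$ be the number of integers $j$ with $|j|\le r$ for which $X_j>x$. Then $$P(M=q\mid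 X_0>x)\to 1\quad\text{as } x\to\infty .$$ -/

import Mathlib

open MeasureTheory ProbabilityTheory Filter Topology Asymptotics

noncomputable section

/-- The moving average `X i = ∑ₖ θ k * ε (i + k)`, `i ∈ ℤ`. The sum is a `finsum`, a genuine finite
sum whenever `θ` has finite support. -/
def movingAverage {Ω : Type*} (θ : ℤ → ℝ) (ε : ℤ → Ω → ℝ) (i : ℤ) (ω : Ω) : ℝ :=
  ∑ᶠ k : ℤ, θ k * ε (i + k) ω

/-- The real random variable `Y` has the (Borel measurable, nonnegative) function `f` as a density
with respect to Lebesgue measure. -/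
structure HasDensity {Ω : Type*} [MeasurableSpace Ω] (P : Measure Ω) (Y : Ω → ℝ) (f : ℝ → ℝ) :
    Prop where
  measurable : Measurable f
  nonneg : ∀ x, 0 ≤ f x
  map_eq : P.map Y = volume.withDensity fun x => ENNReal.ofReal (f x)

/-- `f x = exp (o(x ^ γ)) * exp (-C * x ^ γ)` as `x → ∞`. -/
def RoughWeibullTail (f : ℝ → ℝ) (C γ : ℝ) : Prop :=
  ∃ g : ℝ → ℝ, g =o[atTop] (fun x : ℝ => x ^ γ) ∧
    ∀ᶠ x : ℝ in atTop, f x = Real.exp (g x) * Real.exp (-C * x ^ γ)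

/-- `f x ∼ C₁ * x ^ C₂ * exp (-C * x ^ γ)` as `x → ∞`. -/
def ExactWeibullTail (f : ℝ → ℝ) (C C₁ C₂ γ : ℝ) : Prop :=
  f ~[atTop] fun x : ℝ => C₁ * x ^ C₂ * Real.exp (-C * x ^ γ)

/-- Absence of asymptotic clustering: for each `i₀ ≥ 1`,
`P(X i > x for some i with 1 ≤ |i| ≤ i₀ ∣ X 0 > x) → 0` as `x → ∞`. Here `cond P B A` is the
conditional probability of `A` given `B`. -/
def NoClustering {Ω : Type*} [MeasurableSpace Ω] (P : Measure Ω) (X : ℤ → Ω → ℝ) : Prop :=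
  ∀ i₀ : ℕ, 1 ≤ i₀ →
    Tendsto (fun x : ℝ =>
      cond P {ω | x < X 0 ω} {ω | ∃ i : ℤ, 1 ≤ |i| ∧ |i| ≤ (i₀ : ℤ) ∧ x < X i ω})
      atTop (𝓝 0)

/-- The number `M` of indices `j` with `|j| ≤ r` for which `X j > x`. -/
def exceedanceCount {Ω : Type*} (X : ℤ → Ω → ℝ) (r : ℤ) (x : ℝ) (ω : Ω) : ℕ :=
  ((Finset.Icc (-r) r).filter fun j => x < X j ω).card

/-- The set of indices at which the weight sequence `θ` attains its maximum. -/
def maximizers (θ : ℤ → ℝ) : Set ℤ := {ℓ | ∀ k, θ k ≤ θ ℓ}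

end

/-!
A sum of independent variables with a tail of Weibull type, `0 < γ < 1`, is large because a single
summand is large. Dividing by the largest weight, one may assume that this weight is `1`; then
`X 0 > x` has, up to constants and bounded shifts of `x`, at least the probability that one `ε`
exceeds `x` (`exists_tail_sum_ge`). Nothing is assumed about the left tail of `ε`, so upper bounds
are proved for sums of positive parts.

If the largest weight is attained once, `X 0 > x` and `X i > x` with `i ≠ 0` imply
`X 0 + X i > 2 * x`, and the coefficients of `(X 0 + X i) / 2` are bounded by some `w < 1`. As
`x ^ γ` is subadditive, Chernoff's bound for `∑ (ε k)⁺ ^ γ` (`exists_tail_posPart_sum_le_exp`)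
gives `P (∑ (ε k)⁺ > x / w) ≤ c * exp (-s * (x / w) ^ γ)` for each `s < C`. With `s` close to `C`,
this is exponentially smaller than `P (X 0 > x) ≥ exp (-(C + o(1)) * x ^ γ)`, for all `i` in a
bounded range at once.

If the largest weight is attained `q` times and the density is exactly of Weibull type, the tail of
`ε` has the order of `weibull C γ a x = x ^ a * exp (-C * x ^ γ)` with `a = C₂ + 1 - γ`
(`HasDensity.tail_le`, `HasDensity.le_tail`). Strict concavity of `x ^ γ` makes this tail
subexponential (`HasDensity.convolution_le`), hence, relative to `P (X 0 > x)`, it is unlikely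
that two of the variables in `X 0` are large (`eventually_two_large_le`), or that any other
variable near the origin is large (`eventually_large_outside_le`). It is also unlikely that the
large variable lies beyond `(1 + η) * x` (`eventually_weibull_mul_le`) or within a bounded distance
of `x` (`HasDensity.eventually_window_le`). Off these events one `ε j` is large, its weight in
`X 0` is maximal, and `X i > x` precisely for the `q` indices `i` for which its weight in `X i` is
maximal (`exceedanceCount_eq_card`).
-/

/-! ### The functions `x ^ a * exp (-C * x ^ γ)` -/

section Weibull

/-- The function `x ^ a * exp (-C * x ^ γ)`. -/
noncomputable def weibull (C γ a x : ℝ) : ℝ := x ^ a * Real.exp (-C * x ^ γ)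

variable {C γ a : ℝ}

lemma weibull_nonneg {x : ℝ} (hx : 0 ≤ x) : 0 ≤ weibull C γ a x := by
  unfold weibull; positivity

lemma weibull_pos {x : ℝ} (hx : 0 < x) : 0 < weibull C γ a x := by
  unfold weibull; positivity

lemma integrableOn_weibull (hC : 0 < C) (hγ : 0 < γ) (ha : -1 < a) :
    IntegrableOn (weibull C γ a) (Set.Ioi 0) := by
  apply Integrable.of_integral_ne_zero
  have h := integral_rpow_mul_exp_neg_mul_rpow hγ ha hC
  have hG : 0 < Real.Gamma ((a + 1) / γ) := Real.Gamma_pos_of_pos (by apply div_pos <;> linarith)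
  simp only [weibull]
  rw [h]
  positivity

lemma tendsto_weibull_zero (hC : 0 < C) (hγ : 0 < γ) :
    Tendsto (weibull C γ a) atTop (𝓝 0) := by
  have h := (tendsto_rpow_mul_exp_neg_mul_atTop_nhds_zero (a / γ) C hC).comp
    (tendsto_rpow_atTop hγ)
  refine h.congr' ?_
  filter_upwards [eventually_gt_atTop 0] with x hx
  simp only [Function.comp, weibull]
  rw [← Real.rpow_mul hx.le, mul_div_cancel₀ _ hγ.ne']

lemma hasDerivAt_weibull {x : ℝ} (hx : 0 < x) :
    HasDerivAt (weibull C γ a)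
      (-(C * γ * weibull C γ (a + γ - 1) x - a * weibull C γ (a - 1) x)) x := by
  have h1 : HasDerivAt (fun y : ℝ => y ^ a) (a * x ^ (a - 1)) x :=
    Real.hasDerivAt_rpow_const (Or.inl hx.ne')
  have h2 : HasDerivAt (fun y : ℝ => y ^ γ) (γ * x ^ (γ - 1)) x :=
    Real.hasDerivAt_rpow_const (Or.inl hx.ne')
  have h3 := h1.mul (h2.const_mul (-C)).exp
  refine h3.congr_deriv ?_
  have : x ^ (a + γ - 1) = x ^ a * x ^ (γ - 1) := by
    rw [← Real.rpow_add hx]; ring_nf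
  simp only [weibull, this]
  ring

/-- Shifting the argument costs only a constant factor, since `x ^ γ` is subadditive. -/
lemma weibull_le_exp_mul_weibull_add {x K : ℝ} (hC : 0 ≤ C) (hγ : 0 ≤ γ) (hγ1 : γ ≤ 1) (ha : 0 ≤ a)
    (hx : 0 ≤ x) (hK : 0 ≤ K) :
    weibull C γ a x ≤ Real.exp (C * K ^ γ) * weibull C γ a (x + K) := by
  have h1 : x ^ a ≤ (x + K) ^ a := Real.rpow_le_rpow hx (by linarith) ha
  have h2 : (x + K) ^ γ ≤ x ^ γ + K ^ γ := Real.rpow_add_le_add_rpow hx hK hγ hγ1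
  have h3 : Real.exp (-C * x ^ γ) ≤ Real.exp (C * K ^ γ) * Real.exp (-C * (x + K) ^ γ) := by
    rw [← Real.exp_add]
    apply Real.exp_le_exp.2
    nlinarith [mul_le_mul_of_nonneg_left h2 hC]
  unfold weibull
  calc x ^ a * Real.exp (-C * x ^ γ)
      ≤ (x + K) ^ a * (Real.exp (C * K ^ γ) * Real.exp (-C * (x + K) ^ γ)) := by gcongr
    _ = _ := by ring

lemma eventually_weibull_mul_le (hC : 0 < C) (hγ : 0 < γ) {η δ : ℝ} (hη : 1 < η)
    (hδ : 0 < δ) : ∀ᶠ x in atTop, weibull C γ a (η * x) ≤ δ * weibull C γ a x := by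
  have hη0 : 0 < η := by linarith
  have h1 : 1 < η ^ γ := Real.one_lt_rpow hη hγ
  have h2 : Tendsto (fun x : ℝ => η ^ a * Real.exp (-(C * (η ^ γ - 1)) * x ^ γ)) atTop
      (𝓝 (η ^ a * 0)) := by
    refine Tendsto.const_mul _ (Real.tendsto_exp_atBot.comp ?_)
    exact (tendsto_rpow_atTop hγ).const_mul_atTop_of_neg
      (by have := mul_pos hC (sub_pos.2 h1); linarith)
  rw [mul_zero] at h2
  filter_upwards [h2.eventually_lt_const hδ, eventually_gt_atTop 0] with x hx hx0
  have h3 : weibull C γ a (η * x)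
      = η ^ a * Real.exp (-(C * (η ^ γ - 1)) * x ^ γ) * weibull C γ a x := by
    unfold weibull
    rw [Real.mul_rpow hη0.le hx0.le, Real.mul_rpow hη0.le hx0.le,
      show -C * (η ^ γ * x ^ γ) = -(C * (η ^ γ - 1)) * x ^ γ + -C * x ^ γ by ring, Real.exp_add]
    ring
  rw [h3]
  exact mul_le_mul_of_nonneg_right hx.le (weibull_nonneg hx0.le)

/-- A quantitative form of the strict subadditivity of `x ^ γ` for `γ < 1`. It follows from
concavity, as both `2 * m` and `M` are convex combinations of `m` and `m + M`. -/
lemma add_rpow_add_le {m M : ℝ} (hγ : 0 ≤ γ) (hγ1 : γ ≤ 1) (hm : 0 < m) (hmM : m ≤ M) :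
    (m + M) ^ γ + (2 - 2 ^ γ) * m ^ γ ≤ m ^ γ + M ^ γ := by
  have hM : 0 < M := hm.trans_le hmM
  have hc := Real.concaveOn_rpow hγ hγ1
  set t := m / M with ht
  have ht0 : 0 ≤ t := by positivity
  have ht1 : 0 ≤ 1 - t := by
    have : t ≤ 1 := (div_le_one hM).2 hmM
    linarith
  have htM : t * M = m := by rw [ht]; field_simp
  have h1 := hc.2 (x := m) (y := m + M) hm.le (by simp only [Set.mem_Ici]; positivity) ht1 ht0
    (by ring)
  have h2 := hc.2 (x := m) (y := m + M) hm.le (by simp only [Set.mem_Ici]; positivity) ht0 ht1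
    (by ring)
  simp only [smul_eq_mul] at h1 h2
  rw [show (1 - t) * m + t * (m + M) = 2 * m by linear_combination htM] at h1
  rw [show t * m + (1 - t) * (m + M) = M by linear_combination -htM] at h2
  rw [Real.mul_rpow (by norm_num) hm.le] at h1
  linarith

/-- The pointwise estimate behind subexponentiality: the convolution kernel of two Weibull
functions is, relative to the Weibull function of the sum, small unless one of the arguments is
of moderate size. -/
lemma weibull_mul_weibull_le {b y z : ℝ} (hC : 0 ≤ C) (hγ : 0 ≤ γ) (hγ1 : γ ≤ 1) (ha : 0 ≤ a)
    (hb : b ≤ a) (hy : 1 ≤ y) (hz : 1 ≤ z) :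
    weibull C γ b y * weibull C γ a z ≤ weibull C γ a (y + z) *
      (weibull (C * (2 - 2 ^ γ)) γ a y + weibull (C * (2 - 2 ^ γ)) γ a z) := by
  have hby : weibull C γ b y ≤ weibull C γ a y := by
    unfold weibull
    have := Real.rpow_le_rpow_of_exponent_le hy hb
    gcongr
  have key : ∀ m M : ℝ, 1 ≤ m → m ≤ M → weibull C γ a m * weibull C γ a M ≤
      weibull C γ a (m + M) * weibull (C * (2 - 2 ^ γ)) γ a m := by
    intro m M hm hmM
    have hm0 : 0 < m := by linarith
    have hM0 : 0 < M := by linarith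
    have h1 := add_rpow_add_le hγ hγ1 hm0 hmM
    have h2 : M ^ a ≤ (m + M) ^ a := Real.rpow_le_rpow hM0.le (by linarith) ha
    have h3 : Real.exp (-C * m ^ γ) * Real.exp (-C * M ^ γ) ≤
        Real.exp (-C * (m + M) ^ γ) * Real.exp (-(C * (2 - 2 ^ γ)) * m ^ γ) := by
      rw [← Real.exp_add, ← Real.exp_add]
      apply Real.exp_le_exp.2
      nlinarith [mul_le_mul_of_nonneg_left h1 hC]
    unfold weibull
    calc m ^ a * Real.exp (-C * m ^ γ) * (M ^ a * Real.exp (-C * M ^ γ))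
        = (m ^ a * M ^ a) * (Real.exp (-C * m ^ γ) * Real.exp (-C * M ^ γ)) := by ring
      _ ≤ (m ^ a * (m + M) ^ a) *
          (Real.exp (-C * (m + M) ^ γ) * Real.exp (-(C * (2 - 2 ^ γ)) * m ^ γ)) := by gcongr
      _ = _ := by ring
  have hy0 : 0 ≤ y := by linarith
  have hz0 : 0 ≤ z := by linarith
  refine (mul_le_mul_of_nonneg_right hby (weibull_nonneg hz0)).trans ?_
  rw [mul_add]
  have p1 : 0 ≤ weibull C γ a (y + z) * weibull (C * (2 - 2 ^ γ)) γ a y :=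
    mul_nonneg (weibull_nonneg (by linarith)) (weibull_nonneg hy0)
  have p2 : 0 ≤ weibull C γ a (y + z) * weibull (C * (2 - 2 ^ γ)) γ a z :=
    mul_nonneg (weibull_nonneg (by linarith)) (weibull_nonneg hz0)
  rcases le_total y z with h | h
  · linarith [key y z hy h]
  · have := key z y hz h
    rw [mul_comm, add_comm z y] at this
    linarith

/-- The tail integral of `-(weibull C γ a)'`. -/
lemma lintegral_deriv_weibull (hC : 0 < C) (hγ : 0 < γ) {x : ℝ} (hx : 0 < x)
    (hpos : ∀ y, x < y → 0 ≤ C * γ * weibull C γ (a + γ - 1) y - a * weibull C γ (a - 1) y) :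
    ∫⁻ y in Set.Ioi x,
      ENNReal.ofReal (C * γ * weibull C γ (a + γ - 1) y - a * weibull C γ (a - 1) y) =
    ENNReal.ofReal (weibull C γ a x) := by
  have hd : ∀ y ∈ Set.Ici x, HasDerivAt (weibull C γ a)
      (-(C * γ * weibull C γ (a + γ - 1) y - a * weibull C γ (a - 1) y)) y :=
    fun y hy => hasDerivAt_weibull (hx.trans_le hy)
  have hneg : ∀ y ∈ Set.Ioi x,
      -(C * γ * weibull C γ (a + γ - 1) y - a * weibull C γ (a - 1) y) ≤ 0 :=
    fun y hy => neg_nonpos.2 (hpos y hy)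
  have h1 := integral_Ioi_of_hasDerivAt_of_nonpos' hd hneg (tendsto_weibull_zero hC hγ)
  have h2 := integrableOn_Ioi_deriv_of_nonpos' hd hneg (tendsto_weibull_zero hC hγ)
  rw [integral_neg] at h1
  have h3 := h2.neg
  simp only [Pi.neg_def, neg_neg] at h3
  rw [← ofReal_integral_eq_lintegral_ofReal h3
    (ae_restrict_of_forall_mem measurableSet_Ioi hpos)]
  congr 1
  linarith

end Weibull

/-! ### Tails of densities with exact Weibull decay -/

section Density

variable {Ω : Type*} [MeasurableSpace Ω] {P : Measure Ω} {Y : Ω → ℝ} {f : ℝ → ℝ}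

lemma HasDensity.measure_preimage (hd : HasDensity P Y f) (hY : Measurable Y) {A : Set ℝ}
    (hA : MeasurableSet A) : P (Y ⁻¹' A) = ∫⁻ y in A, ENNReal.ofReal (f y) := by
  rw [← Measure.map_apply hY hA, hd.map_eq, withDensity_apply _ hA]

variable {C C₁ C₂ γ : ℝ}

lemma ExactWeibullTail.eventually_bounds (hC₁ : 0 < C₁) (hf : ExactWeibullTail f C C₁ C₂ γ) :
    ∀ᶠ x in atTop, C₁ / 2 * weibull C γ C₂ x ≤ f x ∧ f x ≤ 2 * C₁ * weibull C γ C₂ x := by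
  obtain ⟨φ, hφ, he⟩ := hf.exists_eq_mul
  filter_upwards [he, hφ.eventually_const_lt (show (1 / 2 : ℝ) < 1 by norm_num),
    hφ.eventually_lt_const (show (1 : ℝ) < 2 by norm_num), eventually_gt_atTop 0] with x hx h1 h2 h0
  have hw : 0 < weibull C γ C₂ x := weibull_pos h0
  have hfx : f x = φ x * (C₁ * weibull C γ C₂ x) := by
    rw [hx, Pi.mul_apply, weibull, mul_assoc]
  have := mul_pos hC₁ hw
  constructor <;> rw [hfx] <;> nlinarith

/-- Eventually, `x ^ C₂ * exp (-C * x ^ γ)` is comparable to the derivative of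
`-x ^ a * exp (-C * x ^ γ)`, where `a = C₂ + 1 - γ`. -/
lemma eventually_deriv_weibull_bounds (hC : 0 < C) (hγ : 0 < γ) (hγ1 : γ < 1) (hC₂ : 0 ≤ C₂) :
    ∀ᶠ y in atTop,
      C * γ / 2 * weibull C γ C₂ y ≤ C * γ * weibull C γ (C₂ + 1 - γ + γ - 1) y
        - (C₂ + 1 - γ) * weibull C γ (C₂ + 1 - γ - 1) y ∧
      C * γ * weibull C γ (C₂ + 1 - γ + γ - 1) y
        - (C₂ + 1 - γ) * weibull C γ (C₂ + 1 - γ - 1) y ≤ C * γ * weibull C γ C₂ y := by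
  have ha : 0 < C₂ + 1 - γ := by linarith
  have h1 : Tendsto (fun y : ℝ => (C₂ + 1 - γ) * y ^ (-γ)) atTop (𝓝 ((C₂ + 1 - γ) * 0)) :=
    (tendsto_rpow_neg_atTop hγ).const_mul _
  rw [mul_zero] at h1
  have hCγ : 0 < C * γ / 2 := by positivity
  filter_upwards [h1.eventually_lt_const hCγ, eventually_gt_atTop 0] with y hy hy0
  have e1 : C₂ + 1 - γ + γ - 1 = C₂ := by ring
  have e2 : weibull C γ (C₂ + 1 - γ - 1) y = y ^ (-γ) * weibull C γ C₂ y := by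
    unfold weibull
    rw [show C₂ + 1 - γ - 1 = -γ + C₂ by ring, Real.rpow_add hy0]
    ring
  have hw : 0 < weibull C γ C₂ y := weibull_pos hy0
  rw [e1, e2]
  constructor
  · nlinarith
  · have : 0 ≤ (C₂ + 1 - γ) * (y ^ (-γ) * weibull C γ C₂ y) := by positivity
    linarith

lemma HasDensity.tail_le [IsFiniteMeasure P] (hd : HasDensity P Y f) (hY : Measurable Y)
    (hC : 0 < C) (hC₁ : 0 < C₁) (hC₂ : 0 ≤ C₂) (hγ : 0 < γ) (hγ1 : γ < 1)
    (hf : ExactWeibullTail f C C₁ C₂ γ) :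
    ∃ c, 0 < c ∧ ∀ᶠ x in atTop, P.real {ω | x < Y ω} ≤ c * weibull C γ (C₂ + 1 - γ) x := by
  refine ⟨4 * C₁ / (C * γ), by positivity, ?_⟩
  filter_upwards [(eventually_forall_ge_atTop.2 (hf.eventually_bounds hC₁)),
    eventually_forall_ge_atTop.2 (eventually_deriv_weibull_bounds hC hγ hγ1 hC₂), eventually_gt_atTop 0]
    with x h1 h2 h0
  have hpos : ∀ y, x < y → 0 ≤ C * γ * weibull C γ (C₂ + 1 - γ + γ - 1) y
      - (C₂ + 1 - γ) * weibull C γ (C₂ + 1 - γ - 1) y := by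
    intro y hy
    refine le_trans ?_ (h2 y hy.le).1
    have := weibull_nonneg (C := C) (γ := γ) (a := C₂) (h0.trans hy).le
    positivity
  have hw := weibull_nonneg (C := C) (γ := γ) (a := C₂ + 1 - γ) h0.le
  refine ENNReal.toReal_le_of_le_ofReal (by positivity) ?_
  change P (Y ⁻¹' Set.Ioi x) ≤ _
  rw [hd.measure_preimage hY measurableSet_Ioi, ENNReal.ofReal_mul (by positivity),
    ← lintegral_deriv_weibull hC hγ h0 hpos, ← lintegral_const_mul' _ _ ENNReal.ofReal_ne_top]
  refine setLIntegral_mono' measurableSet_Ioi fun y hy => ?_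
  rw [← ENNReal.ofReal_mul (by positivity)]
  apply ENNReal.ofReal_le_ofReal
  refine (h1 y (le_of_lt hy)).2.trans ?_
  calc 2 * C₁ * weibull C γ C₂ y
      = 4 * C₁ / (C * γ) * (C * γ / 2 * weibull C γ C₂ y) := by field_simp; ring
    _ ≤ _ := by gcongr; exact (h2 y (le_of_lt hy)).1

lemma HasDensity.le_tail [IsFiniteMeasure P] (hd : HasDensity P Y f) (hY : Measurable Y)
    (hC : 0 < C) (hC₁ : 0 < C₁) (hC₂ : 0 ≤ C₂) (hγ : 0 < γ) (hγ1 : γ < 1)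
    (hf : ExactWeibullTail f C C₁ C₂ γ) :
    ∃ c, 0 < c ∧ ∀ᶠ x in atTop, c * weibull C γ (C₂ + 1 - γ) x ≤ P.real {ω | x < Y ω} := by
  refine ⟨C₁ / (2 * (C * γ)), by positivity, ?_⟩
  filter_upwards [(eventually_forall_ge_atTop.2 (hf.eventually_bounds hC₁)),
    eventually_forall_ge_atTop.2 (eventually_deriv_weibull_bounds hC hγ hγ1 hC₂), eventually_gt_atTop 0]
    with x h1 h2 h0
  have hpos : ∀ y, x < y → 0 ≤ C * γ * weibull C γ (C₂ + 1 - γ + γ - 1) y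
      - (C₂ + 1 - γ) * weibull C γ (C₂ + 1 - γ - 1) y := by
    intro y hy
    refine le_trans ?_ (h2 y hy.le).1
    have := weibull_nonneg (C := C) (γ := γ) (a := C₂) (h0.trans hy).le
    positivity
  refine (ENNReal.ofReal_le_iff_le_toReal (measure_ne_top _ _)).1 ?_
  change _ ≤ P (Y ⁻¹' Set.Ioi x)
  rw [hd.measure_preimage hY measurableSet_Ioi, ENNReal.ofReal_mul (by positivity),
    ← lintegral_deriv_weibull hC hγ h0 hpos, ← lintegral_const_mul' _ _ ENNReal.ofReal_ne_top]
  refine setLIntegral_mono' measurableSet_Ioi fun y hy => ?_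
  rw [← ENNReal.ofReal_mul (by positivity)]
  apply ENNReal.ofReal_le_ofReal
  refine le_trans ?_ (h1 y (le_of_lt hy)).1
  calc _ ≤ C₁ / (2 * (C * γ)) * (C * γ * weibull C γ C₂ y) := by
        gcongr; exact (h2 y (le_of_lt hy)).2
    _ = C₁ / 2 * weibull C γ C₂ y := by field_simp

/-- A window of bounded length around `x` is asymptotically negligible compared with the tail
beyond `x`, because the tail is of order `x ^ (1 - γ)` times the density. -/
lemma HasDensity.eventually_window_le [IsFiniteMeasure P] (hd : HasDensity P Y f)
    (hY : Measurable Y) (hC : 0 < C) (hC₁ : 0 < C₁) (hC₂ : 0 ≤ C₂) (hγ : 0 < γ) (hγ1 : γ < 1)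
    (hf : ExactWeibullTail f C C₁ C₂ γ) {K δ : ℝ} (hK : 0 < K) (hδ : 0 < δ) :
    ∀ᶠ x in atTop, P.real {ω | x - K < Y ω ∧ Y ω ≤ x + K} ≤
      δ * weibull C γ (C₂ + 1 - γ) x := by
  set D : ℝ := 2 * K * (2 * C₁ * (2 ^ C₂ * Real.exp (C * K ^ γ))) with hD
  have hD0 : 0 < D := by positivity
  have h1 : Tendsto (fun x : ℝ => D * x ^ (-(1 - γ))) atTop (𝓝 (D * 0)) :=
    (tendsto_rpow_neg_atTop (by linarith)).const_mul _
  rw [mul_zero] at h1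
  filter_upwards [h1.eventually_lt_const hδ, eventually_gt_atTop (2 * K),
    (tendsto_atTop_add_const_right _ (-K) tendsto_id).eventually
      (eventually_forall_ge_atTop.2 (hf.eventually_bounds hC₁))] with x hx hxK hfx
  simp only [id] at hfx
  have hx0 : 0 < x := by linarith
  have hw := weibull_nonneg (C := C) (γ := γ) (a := C₂ + 1 - γ) hx0.le
  have hw2 := weibull_nonneg (C := C) (γ := γ) (a := C₂) hx0.le
  have hpt : ∀ y ∈ Set.Ioc (x - K) (x + K),
      f y ≤ 2 * C₁ * (2 ^ C₂ * Real.exp (C * K ^ γ)) * weibull C γ C₂ x := by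
    intro y hy
    have hy0 : 0 < y := by linarith [hy.1]
    have e1 : y ^ C₂ ≤ 2 ^ C₂ * x ^ C₂ := by
      rw [← Real.mul_rpow (by norm_num) hx0.le]
      exact Real.rpow_le_rpow hy0.le (by linarith [hy.2]) hC₂
    have e2 : x ^ γ ≤ y ^ γ + K ^ γ :=
      (Real.rpow_le_rpow hx0.le (by linarith [hy.1]) hγ.le).trans
        (Real.rpow_add_le_add_rpow hy0.le hK.le hγ.le hγ1.le)
    have e3 : Real.exp (-C * y ^ γ) ≤ Real.exp (C * K ^ γ) * Real.exp (-C * x ^ γ) := by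
      rw [← Real.exp_add]
      apply Real.exp_le_exp.2
      nlinarith [mul_le_mul_of_nonneg_left e2 hC.le]
    refine (hfx y (by linarith [hy.1])).2.trans ?_
    unfold weibull
    calc 2 * C₁ * (y ^ C₂ * Real.exp (-C * y ^ γ))
        ≤ 2 * C₁ * (2 ^ C₂ * x ^ C₂ * (Real.exp (C * K ^ γ) * Real.exp (-C * x ^ γ))) := by
          gcongr
      _ = _ := by ring
  have hdw : D * weibull C γ C₂ x ≤ δ * weibull C γ (C₂ + 1 - γ) x := by
    have : weibull C γ C₂ x = x ^ (-(1 - γ)) * weibull C γ (C₂ + 1 - γ) x := by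
      unfold weibull
      rw [← mul_assoc, ← Real.rpow_add hx0]
      ring_nf
    rw [this, ← mul_assoc]
    gcongr
  refine le_trans ?_ hdw
  refine ENNReal.toReal_le_of_le_ofReal (by positivity) ?_
  change P (Y ⁻¹' Set.Ioc (x - K) (x + K)) ≤ _
  rw [hd.measure_preimage hY measurableSet_Ioc]
  refine (setLIntegral_mono' measurableSet_Ioc
    fun y hy => ENNReal.ofReal_le_ofReal (hpt y hy)).trans ?_
  rw [setLIntegral_const, Real.volume_Ioc, ← ENNReal.ofReal_mul (by positivity)]
  apply ENNReal.ofReal_le_ofReal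
  apply le_of_eq
  rw [hD]; ring

lemma eventually_lintegral_Ioi_le {g : ℝ → ℝ} (hg : IntegrableOn g (Set.Ioi 0)) {δ : ℝ}
    (hδ : 0 < δ) : ∀ᶠ K in atTop, ∫⁻ y in Set.Ioi K, ENNReal.ofReal (g y) ≤ ENNReal.ofReal δ := by
  have h1 : Tendsto (fun K : ℝ => ∫⁻ y in Set.Ioi K, ENNReal.ofReal (g y)) atTop (𝓝 0) := by
    have hfin : ∫⁻ y in Set.Ioi 0, ENNReal.ofReal (g y) ≠ ⊤ :=
      ((lintegral_mono fun y => Real.ofReal_le_enorm _).trans_lt hg.2).ne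
    have := tendsto_measure_iInter_atTop
      (μ := volume.withDensity fun y => ENNReal.ofReal (g y)) (s := fun K : ℝ => Set.Ioi K)
      (fun K => measurableSet_Ioi.nullMeasurableSet) (fun _ _ h => Set.Ioi_subset_Ioi h)
      ⟨0, by rwa [withDensity_apply _ measurableSet_Ioi]⟩
    rw [show (⋂ K : ℝ, Set.Ioi K) = ∅ by
      ext y; simp only [Set.mem_iInter, Set.mem_Ioi, Set.mem_empty_iff_false, iff_false, not_forall,
        not_lt]; exact ⟨y, le_rfl⟩, measure_empty] at this
    refine this.congr fun K => ?_
    rw [Function.comp_apply, withDensity_apply _ measurableSet_Ioi]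
  exact (h1.eventually_lt_const (ENNReal.ofReal_pos.2 hδ)).mono fun _ h => h.le

/-- If `Y` and `W` are independent, the event `K < Y ≤ x - K, Y + W > x` is negligible, uniformly
in `x`, as `K` grows: this is the subexponentiality of the Weibull tail. -/
lemma HasDensity.convolution_le [IsProbabilityMeasure P] (hd : HasDensity P Y f)
    (hY : Measurable Y) (hC : 0 < C) (hC₁ : 0 < C₁) (hC₂ : 0 ≤ C₂) (hγ : 0 < γ) (hγ1 : γ < 1)
    (hf : ExactWeibullTail f C C₁ C₂ γ) {W : Ω → ℝ} (hW : Measurable W) (hind : IndepFun Y W P)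
    {c : ℝ} (hc : 0 < c)
    (hWt : ∀ᶠ x in atTop, P.real {ω | x < W ω} ≤ c * weibull C γ (C₂ + 1 - γ) x)
    {δ : ℝ} (hδ : 0 < δ) :
    ∀ᶠ K in atTop, ∀ x, 0 ≤ x →
      P.real {ω | (K < Y ω ∧ Y ω ≤ x - K) ∧ x < Y ω + W ω} ≤
        δ * weibull C γ (C₂ + 1 - γ) x := by
  have h2γ : (0 : ℝ) < 2 - 2 ^ γ := by
    have : (2 : ℝ) ^ γ < 2 ^ (1 : ℝ) := Real.rpow_lt_rpow_of_exponent_lt (by norm_num) hγ1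
    rw [Real.rpow_one] at this
    linarith
  set a := C₂ + 1 - γ with ha_def
  have ha : 0 < a := by linarith
  set φ := weibull (C * (2 - 2 ^ γ)) γ a with hφ
  have hφi : IntegrableOn φ (Set.Ioi 0) := integrableOn_weibull (mul_pos hC h2γ) hγ (by linarith)
  have hφm : Measurable φ := by unfold φ; unfold weibull; fun_prop
  set D := 2 * C₁ * c with hD
  have hD0 : 0 < D := by positivity
  filter_upwards [eventually_lintegral_Ioi_le hφi (show 0 < δ / (2 * D) by positivity),
    eventually_forall_ge_atTop.2 hWt, (eventually_forall_ge_atTop.2 (hf.eventually_bounds hC₁)), eventually_ge_atTop 1]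
    with K hK hWK hfK hK1 x hx
  have hw := weibull_nonneg (C := C) (γ := γ) (a := a) hx
  refine ENNReal.toReal_le_of_le_ofReal (by positivity) ?_
  set A : Set (ℝ × ℝ) := {p | (K < p.1 ∧ p.1 ≤ x - K) ∧ x < p.1 + p.2} with hA
  have hAm : MeasurableSet A :=
    ((measurableSet_lt measurable_const measurable_fst).inter
      (measurableSet_le measurable_fst measurable_const)).inter
      (measurableSet_lt measurable_const (measurable_fst.add measurable_snd))
  have hPA : P {ω | (K < Y ω ∧ Y ω ≤ x - K) ∧ x < Y ω + W ω}
      = ∫⁻ y, P.map W (Prod.mk y ⁻¹' A) ∂(P.map Y) := by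
    have := Measure.isProbabilityMeasure_map (μ := P) hW.aemeasurable
    rw [← Measure.prod_apply hAm,
      ← (indepFun_iff_map_prod_eq_prod_map_map hY.aemeasurable hW.aemeasurable).1 hind,
      Measure.map_apply (hY.prodMk hW) hAm]
    rfl
  have hle : ∀ y, P.map W (Prod.mk y ⁻¹' A) ≤
      (Set.Ioc K (x - K)).indicator
        (fun y => ENNReal.ofReal (c * weibull C γ a (x - y))) y := by
    intro y
    by_cases hy : y ∈ Set.Ioc K (x - K)
    · rw [Set.indicator_of_mem hy]
      rw [Measure.map_apply hW (measurable_prodMk_left hAm)]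
      refine (measure_mono (t := {ω | x - y < W ω}) ?_).trans ?_
      · intro ω hω
        have : x < y + W ω := hω.2
        change x - y < W ω
        linarith
      · rw [← ofReal_measureReal]
        exact ENNReal.ofReal_le_ofReal (hWK _ (by linarith [hy.2]))
    · have : Prod.mk y ⁻¹' A = ∅ := by
        ext w
        simp only [Set.mem_preimage, Set.mem_empty_iff_false, iff_false]
        exact fun h => hy h.1
      simp [this]
  have hmeas : Measurable (fun y => (Set.Ioc K (x - K)).indicator
      (fun y => ENNReal.ofReal (c * weibull C γ a (x - y))) y) := by
    refine Measurable.indicator ?_ measurableSet_Ioc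
    unfold weibull
    fun_prop
  rw [hPA]
  refine (lintegral_mono hle).trans ?_
  rw [hd.map_eq, lintegral_withDensity_eq_lintegral_mul _ hd.measurable.ennreal_ofReal hmeas]
  have hpt : ∀ y, ((fun y => ENNReal.ofReal (f y)) * fun y => (Set.Ioc K (x - K)).indicator
      (fun y => ENNReal.ofReal (c * weibull C γ a (x - y))) y) y ≤
      ENNReal.ofReal (D * weibull C γ a x) *
        ((Set.Ici K).indicator (fun y => ENNReal.ofReal (φ y)) y +
          (Set.Ici K).indicator (fun y => ENNReal.ofReal (φ y)) (x - y)) := by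
    intro y
    rw [Pi.mul_apply]
    by_cases hy : y ∈ Set.Ioc K (x - K)
    · have hyK : K ≤ y := hy.1.le
      have hyK' : K ≤ x - y := by linarith [hy.2]
      rw [Set.indicator_of_mem hy, Set.indicator_of_mem (Set.mem_Ici.2 hyK),
        Set.indicator_of_mem (Set.mem_Ici.2 hyK')]
      have n1 : 0 ≤ φ y := weibull_nonneg (by linarith)
      have n2 : 0 ≤ φ (x - y) := weibull_nonneg (by linarith)
      have n3 : 0 ≤ weibull C γ a (x - y) := weibull_nonneg (by linarith)
      rw [← ENNReal.ofReal_add n1 n2, ← ENNReal.ofReal_mul (hd.nonneg y),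
        ← ENNReal.ofReal_mul (by positivity)]
      apply ENNReal.ofReal_le_ofReal
      have h1 := weibull_mul_weibull_le (C := C) (b := C₂) hC.le hγ.le hγ1.le ha.le
        (by linarith) (hK1.trans hyK) (hK1.trans hyK')
      rw [add_sub_cancel] at h1
      calc f y * (c * weibull C γ a (x - y))
          ≤ 2 * C₁ * weibull C γ C₂ y * (c * weibull C γ a (x - y)) := by
            gcongr; exact (hfK y hyK).2
        _ = D * (weibull C γ C₂ y * weibull C γ a (x - y)) := by rw [hD]; ring
        _ ≤ D * (weibull C γ a x * (φ y + φ (x - y))) := by gcongr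
        _ = _ := by ring
    · rw [Set.indicator_of_notMem hy]; simp
  refine (lintegral_mono hpt).trans ?_
  have hφm' : Measurable ((Set.Ici K).indicator (fun y => ENNReal.ofReal (φ y))) :=
    hφm.ennreal_ofReal.indicator measurableSet_Ici
  rw [lintegral_const_mul' _ _ ENNReal.ofReal_ne_top, lintegral_add_left hφm',
    lintegral_sub_left_eq_self ((Set.Ici K).indicator (fun y => ENNReal.ofReal (φ y))) x,
    lintegral_indicator measurableSet_Ici, setLIntegral_congr Ioi_ae_eq_Ici.symm]
  calc _ ≤ ENNReal.ofReal (D * weibull C γ a x) *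
        (ENNReal.ofReal (δ / (2 * D)) + ENNReal.ofReal (δ / (2 * D))) := by gcongr
    _ = ENNReal.ofReal (δ * weibull C γ a x) := by
      rw [← ENNReal.ofReal_add (by positivity) (by positivity),
        ← ENNReal.ofReal_mul (by positivity)]
      congr 1
      field_simp
      ring

end Density

/-! ### Tails of finite sums -/

section Sums

variable {Ω ι : Type*} [MeasurableSpace Ω] {P : Measure Ω} {ε : ι → Ω → ℝ}

lemma iIndepFun.indepFun_sum_comp (hε_meas : ∀ i, Measurable (ε i)) (hind : iIndepFun ε P)
    {φ : ι → ℝ → ℝ} (hφ : ∀ k, Measurable (φ k)) {s : Finset ι} {j : ι} (hj : j ∉ s) :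
    IndepFun (ε j) (fun ω => ∑ k ∈ s, φ k (ε k ω)) P := by
  have h1 := hind.indepFun_finset {j} s (Finset.disjoint_singleton_left.2 hj) hε_meas
  have hp : Measurable fun v : (({j} : Finset ι) → ℝ) => v ⟨j, Finset.mem_singleton_self j⟩ :=
    measurable_pi_apply _
  have hq : Measurable fun v : (s → ℝ) => ∑ k : s, φ k (v k) := by fun_prop
  have h2 := h1.comp (φ := fun v : (({j} : Finset ι) → ℝ) => v ⟨j, Finset.mem_singleton_self j⟩)
    (ψ := fun v : (s → ℝ) => ∑ k : s, φ k (v k)) hp hq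
  convert! h2 using 1
  ext ω
  exact (Finset.sum_coe_sort s (fun k => φ k (ε k ω))).symm

lemma tendsto_measureReal_lt [IsFiniteMeasure P] {Z : Ω → ℝ} (hZ : Measurable Z) :
    Tendsto (fun K : ℝ => P.real {ω | K < Z ω}) atTop (𝓝 0) := by
  have := tendsto_measure_iInter_atTop (μ := P) (s := fun K : ℝ => {ω | K < Z ω})
    (fun K => (measurableSet_lt measurable_const hZ).nullMeasurableSet)
    (fun _ _ h ω (hω : _ < _) => h.trans_lt hω) ⟨0, measure_ne_top _ _⟩
  rw [show (⋂ K : ℝ, {ω | K < Z ω}) = ∅ by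
    ext ω; simp only [Set.mem_iInter, Set.mem_ofPred_eq, Set.mem_empty_iff_false, iff_false,
      not_forall, not_lt]; exact ⟨Z ω, le_rfl⟩, measure_empty] at this
  have h2 := (ENNReal.tendsto_toReal ENNReal.zero_ne_top).comp this
  exact h2

/-- A weighted sum containing a variable with weight `1` has a tail that, up to a shift and a
constant factor, is at least that of this variable. -/
lemma exists_tail_sum_ge [IsProbabilityMeasure P] (hε_meas : ∀ i, Measurable (ε i))
    (hind : iIndepFun ε P) {θ : ι → ℝ} {S : Finset ι} {l : ι} (hl : l ∈ S) (hθ : θ l = 1) :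
    ∃ K, 0 ≤ K ∧ ∀ x, 1 / 2 * P.real {ω | x + K < ε l ω} ≤
      P.real {ω | x < ∑ k ∈ S, θ k * ε k ω} := by
  classical
  set Z : Ω → ℝ := fun ω => ∑ k ∈ S.erase l, θ k * ε k ω with hZ
  have hZm : Measurable Z := by fun_prop
  have hi : IndepFun (ε l) Z P := iIndepFun.indepFun_sum_comp hε_meas hind
    (φ := fun k y => θ k * y) (fun k => by fun_prop) (Finset.notMem_erase l S)
  obtain ⟨K, hK, hK0⟩ := (((tendsto_measureReal_lt (P := P) hZm.neg).eventually_le_const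
    (show (0 : ℝ) < 1 / 2 by norm_num)).and (eventually_ge_atTop 0)).exists
  refine ⟨K, hK0, fun x => ?_⟩
  have hc : 1 / 2 ≤ P.real {ω | -K ≤ Z ω} := by
    have h1 : {ω | -K ≤ Z ω} = {ω | K < (-Z) ω}ᶜ := by
      ext ω; simp only [Set.mem_ofPred_eq, Set.mem_compl_iff, Pi.neg_apply, not_lt]
      constructor <;> intro h <;> linarith
    rw [h1, probReal_compl_eq_one_sub (measurableSet_lt measurable_const hZm.neg)]
    linarith
  have hprod : P.real ({ω | x + K < ε l ω} ∩ {ω | -K ≤ Z ω}) =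
      P.real {ω | x + K < ε l ω} * P.real {ω | -K ≤ Z ω} := by
    have := hi.measure_inter_preimage_eq_mul (Set.Ioi (x + K)) (Set.Ici (-K)) measurableSet_Ioi
      measurableSet_Ici
    simp only [measureReal_def, ← ENNReal.toReal_mul]
    exact congrArg ENNReal.toReal this
  calc _ ≤ P.real {ω | x + K < ε l ω} * P.real {ω | -K ≤ Z ω} := by
        rw [mul_comm]; gcongr
    _ = _ := hprod.symm
    _ ≤ _ := by
      refine measureReal_mono fun ω hω => ?_
      have h1 : x + K < ε l ω := hω.1
      have h2 : -K ≤ ∑ k ∈ S.erase l, θ k * ε k ω := hω.2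
      change x < ∑ k ∈ S, θ k * ε k ω
      rw [← Finset.add_sum_erase _ _ hl, hθ]
      linarith

lemma eventually_tail_shift_le {Z : Ω → ℝ} {C γ : ℝ} (hC : 0 < C) (hγ : 0 < γ) (hγ1 : γ < 1) {a : ℝ}
    (ha : 0 ≤ a) {c K : ℝ} (hc : 0 < c) (hK : 0 ≤ K)
    (h : ∀ᶠ x in atTop, P.real {ω | x < Z ω} ≤ c * weibull C γ a x) :
    ∀ᶠ x in atTop, P.real {ω | x - K < Z ω} ≤
      c * Real.exp (C * K ^ γ) * weibull C γ a x := by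
  filter_upwards [(tendsto_atTop_add_const_right _ (-K) tendsto_id).eventually h,
    eventually_ge_atTop K] with x hx hxK
  have h1 := weibull_le_exp_mul_weibull_add (x := x - K) hC.le hγ.le hγ1.le ha (by linarith) hK
  rw [sub_add_cancel] at h1
  simp only [id, ← sub_eq_add_neg] at hx
  calc _ ≤ c * weibull C γ a (x - K) := hx
    _ ≤ c * (Real.exp (C * K ^ γ) * weibull C γ a x) := by gcongr
    _ = _ := by ring

/-! ### Sums under exact Weibull decay -/

section Exact

variable [IsProbabilityMeasure P] {f : ℝ → ℝ} {C C₁ C₂ γ : ℝ}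

/-- Finite sums of positive parts have a tail of the same order as a single variable. -/
lemma exists_tail_posPart_sum_le (hε_meas : ∀ i, Measurable (ε i)) (hind : iIndepFun ε P)
    (hd : ∀ i, HasDensity P (ε i) f) (hC : 0 < C) (hC₁ : 0 < C₁) (hC₂ : 0 ≤ C₂) (hγ : 0 < γ)
    (hγ1 : γ < 1) (hf : ExactWeibullTail f C C₁ C₂ γ) (S : Finset ι) :
    ∃ c, 0 < c ∧ ∀ᶠ x in atTop,
      P.real {ω | x < ∑ k ∈ S, max (ε k ω) 0} ≤ c * weibull C γ (C₂ + 1 - γ) x := by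
  classical
  have ha : 0 ≤ C₂ + 1 - γ := by linarith
  induction S using Finset.induction_on with
  | empty =>
    refine ⟨1, one_pos, ?_⟩
    filter_upwards [eventually_ge_atTop 0] with x hx
    rw [show {ω : Ω | x < ∑ k ∈ (∅ : Finset ι), max (ε k ω) 0} = ∅ by
      ext ω; simpa using hx]
    simpa using weibull_nonneg hx
  | insert j s hj ih =>
    obtain ⟨c, hc, hs⟩ := ih
    obtain ⟨c', hc', hj'⟩ := (hd j).tail_le (hε_meas j) hC hC₁ hC₂ hγ hγ1 hf
    have hi := iIndepFun.indepFun_sum_comp hε_meas hind (φ := fun _ y => max y 0)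
      (fun _ => by fun_prop) hj
    have hWm : Measurable fun ω => ∑ k ∈ s, max (ε k ω) 0 := by fun_prop
    obtain ⟨K, hK, hK0⟩ := (((hd j).convolution_le (hε_meas j) hC hC₁ hC₂ hγ hγ1 hf hWm hi hc hs
      one_pos).and (eventually_ge_atTop 0)).exists
    refine ⟨c' * Real.exp (C * K ^ γ) + c * Real.exp (C * K ^ γ) + 1, by positivity, ?_⟩
    filter_upwards [eventually_tail_shift_le hC hγ hγ1 ha hc hK0 hs,
      eventually_tail_shift_le hC hγ hγ1 ha hc' hK0 hj', eventually_ge_atTop 0] with x h1 h2 hx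
    have h3 := hK x hx
    have hsub : {ω | x < ∑ k ∈ insert j s, max (ε k ω) 0} ⊆
        ({ω | x - K < ε j ω} ∪ {ω | x - K < ∑ k ∈ s, max (ε k ω) 0}) ∪
          {ω | (K < ε j ω ∧ ε j ω ≤ x - K) ∧ x < ε j ω + ∑ k ∈ s, max (ε k ω) 0} := by
      intro ω hω
      simp only [Set.mem_ofPred_eq, Finset.sum_insert hj] at hω
      simp only [Set.mem_union, Set.mem_ofPred_eq]
      by_cases e1 : x - K < ε j ω
      · exact Or.inl (Or.inl e1)
      by_cases e2 : K < ε j ω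
      · rw [max_eq_left (by linarith)] at hω
        exact Or.inr ⟨⟨e2, not_lt.1 e1⟩, hω⟩
      · have : max (ε j ω) 0 ≤ K := max_le (not_lt.1 e2) hK0
        exact Or.inl (Or.inr (by linarith))
    calc _ ≤ _ := measureReal_mono hsub
      _ ≤ _ := (measureReal_union_le _ _).trans (add_le_add_left (measureReal_union_le _ _) _)
      _ ≤ _ := by linarith

/-- Two large summands: negligible relative to the tail at `x` once the threshold `K` is large. -/
lemma eventually_two_large_le (hε_meas : ∀ i, Measurable (ε i)) (hind : iIndepFun ε P)
    (hd : ∀ i, HasDensity P (ε i) f) (hC : 0 < C) (hC₁ : 0 < C₁) (hC₂ : 0 ≤ C₂) (hγ : 0 < γ)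
    (hγ1 : γ < 1) (hf : ExactWeibullTail f C C₁ C₂ γ) {s : Finset ι} {j : ι} (hj : j ∉ s)
    {δ : ℝ} (hδ : 0 < δ) :
    ∀ᶠ K in atTop, ∀ᶠ x in atTop,
      P.real {ω | K < ε j ω ∧ K < ∑ k ∈ s, max (ε k ω) 0 ∧
        x < ε j ω + ∑ k ∈ s, max (ε k ω) 0} ≤ δ * weibull C γ (C₂ + 1 - γ) x := by
  have ha : 0 ≤ C₂ + 1 - γ := by linarith
  obtain ⟨c, hc, hs⟩ := exists_tail_posPart_sum_le hε_meas hind hd hC hC₁ hC₂ hγ hγ1 hf s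
  obtain ⟨c', hc', hj'⟩ := (hd j).tail_le (hε_meas j) hC hC₁ hC₂ hγ hγ1 hf
  have hi := iIndepFun.indepFun_sum_comp hε_meas hind (φ := fun _ y => max y 0)
    (fun _ => by fun_prop) hj
  set W : Ω → ℝ := fun ω => ∑ k ∈ s, max (ε k ω) 0 with hW
  have hWm : Measurable W := by fun_prop
  -- the splitting level `L` stays fixed while the threshold `K` grows
  obtain ⟨L, hL, hL0⟩ := (((hd j).convolution_le (hε_meas j) hC hC₁ hC₂ hγ hγ1 hf hWm hi hc hs
    (half_pos hδ)).and (eventually_ge_atTop 0)).exists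
  set D := c' * Real.exp (C * L ^ γ) with hD
  have hD0 : 0 < D := by positivity
  filter_upwards [(tendsto_measureReal_lt (P := P) hWm).eventually_le_const
    (show 0 < δ / (2 * D) by positivity), eventually_ge_atTop L] with K hK hKL
  filter_upwards [eventually_tail_shift_le hC hγ hγ1 ha hc' hL0 hj', eventually_ge_atTop 0]
    with x h1 hx
  have h2 := hL x hx
  have hw := weibull_nonneg (C := C) (γ := γ) (a := C₂ + 1 - γ) hx
  have hsub : {ω | K < ε j ω ∧ K < W ω ∧ x < ε j ω + W ω} ⊆
      ({ω | x - L < ε j ω} ∩ {ω | K < W ω}) ∪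
        {ω | (L < ε j ω ∧ ε j ω ≤ x - L) ∧ x < ε j ω + W ω} := by
    rintro ω ⟨e1, e2, e3⟩
    by_cases e : x - L < ε j ω
    · exact Or.inl ⟨e, e2⟩
    · exact Or.inr ⟨⟨hKL.trans_lt e1, not_lt.1 e⟩, e3⟩
  have hprod : P.real ({ω | x - L < ε j ω} ∩ {ω | K < W ω}) =
      P.real {ω | x - L < ε j ω} * P.real {ω | K < W ω} := by
    have := hi.measure_inter_preimage_eq_mul (Set.Ioi (x - L)) (Set.Ioi K) measurableSet_Ioi
      measurableSet_Ioi
    simp only [measureReal_def, ← ENNReal.toReal_mul]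
    exact congrArg ENNReal.toReal this
  calc _ ≤ _ := measureReal_mono hsub
    _ ≤ _ := measureReal_union_le _ _
    _ ≤ D * weibull C γ (C₂ + 1 - γ) x * (δ / (2 * D)) +
        δ / 2 * weibull C γ (C₂ + 1 - γ) x := by
      rw [hprod]; gcongr
    _ = _ := by field_simp; ring

/-- A large value of a variable outside the sum is independent of the exceedance, hence negligible
relative to the tail at `x` for a large threshold. -/
lemma eventually_large_outside_le (hε_meas : ∀ i, Measurable (ε i)) (hind : iIndepFun ε P)
    (hd : ∀ i, HasDensity P (ε i) f) (hC : 0 < C) (hC₁ : 0 < C₁) (hC₂ : 0 ≤ C₂) (hγ : 0 < γ)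
    (hγ1 : γ < 1) (hf : ExactWeibullTail f C C₁ C₂ γ) {s : Finset ι} {j : ι} (hj : j ∉ s)
    {δ : ℝ} (hδ : 0 < δ) :
    ∀ᶠ K in atTop, ∀ᶠ x in atTop,
      P.real {ω | K < |ε j ω| ∧ x < ∑ k ∈ s, max (ε k ω) 0} ≤
        δ * weibull C γ (C₂ + 1 - γ) x := by
  obtain ⟨c, hc, hs⟩ := exists_tail_posPart_sum_le hε_meas hind hd hC hC₁ hC₂ hγ hγ1 hf s
  have hi := iIndepFun.indepFun_sum_comp hε_meas hind (φ := fun _ y => max y 0)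
    (fun _ => by fun_prop) hj
  set W : Ω → ℝ := fun ω => ∑ k ∈ s, max (ε k ω) 0 with hW
  have hm : Measurable fun ω => |ε j ω| := (hε_meas j).abs
  filter_upwards [(tendsto_measureReal_lt (P := P) hm).eventually_le_const
    (show 0 < δ / c by positivity)] with K hK
  filter_upwards [hs, eventually_ge_atTop 0] with x h1 hx
  have hw := weibull_nonneg (C := C) (γ := γ) (a := C₂ + 1 - γ) hx
  have hprod : P.real {ω | K < |ε j ω| ∧ x < W ω} =
      P.real {ω | K < |ε j ω|} * P.real {ω | x < W ω} := by
    have := hi.measure_inter_preimage_eq_mul {y | K < |y|} (Set.Ioi x)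
      (measurableSet_lt measurable_const (by fun_prop)) measurableSet_Ioi
    simp only [measureReal_def, ← ENNReal.toReal_mul]
    exact congrArg ENNReal.toReal this
  rw [hprod]
  calc _ ≤ δ / c * (c * weibull C γ (C₂ + 1 - γ) x) := by gcongr
    _ = _ := by field_simp

end Exact

/-! ### Sums under rough Weibull decay -/

section Rough

lemma rpow_sum_le_sum_rpow {γ : ℝ} (hγ : 0 < γ) (hγ1 : γ ≤ 1) (s : Finset ι) {z : ι → ℝ}
    (hz : ∀ k, 0 ≤ z k) : (∑ k ∈ s, z k) ^ γ ≤ ∑ k ∈ s, z k ^ γ := by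
  classical
  induction s using Finset.induction_on with
  | empty => simp [Real.zero_rpow hγ.ne']
  | insert j s hj ih =>
    rw [Finset.sum_insert hj, Finset.sum_insert hj]
    have := Real.rpow_add_le_add_rpow (hz j) (Finset.sum_nonneg fun k _ => hz k : 0 ≤ ∑ k ∈ s, z k)
      hγ.le hγ1
    linarith

variable {f : ℝ → ℝ} {C γ : ℝ}

lemma RoughWeibullTail.eventually_bounds (hf : RoughWeibullTail f C γ) {δ : ℝ} (hδ : 0 < δ) :
    ∀ᶠ x in atTop, Real.exp (-(C + δ) * x ^ γ) ≤ f x ∧ f x ≤ Real.exp (-(C - δ) * x ^ γ) := by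
  obtain ⟨g, hg, hfg⟩ := hf
  filter_upwards [hfg, hg.bound hδ, eventually_ge_atTop 0] with x hx hgx h0
  rw [Real.norm_eq_abs, Real.norm_of_nonneg (Real.rpow_nonneg h0 γ), abs_le] at hgx
  rw [hx, ← Real.exp_add]
  constructor <;> apply Real.exp_le_exp.2 <;> nlinarith [hgx.1, hgx.2]

/-- The exponential moment that feeds the Chernoff bound. -/
lemma HasDensity.integrable_exp_mul_rpow {Y : Ω → ℝ} (hd : HasDensity P Y f) (hY : Measurable Y)
    [IsFiniteMeasure P] (hγ : 0 < γ) (hf : RoughWeibullTail f C γ) {s : ℝ} (hs0 : 0 ≤ s)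
    (hs : s < C) : Integrable (fun ω => Real.exp (s * (max (Y ω) 0) ^ γ)) P := by
  set G : ℝ → ℝ := fun y => Real.exp (s * (max y 0) ^ γ) with hG
  have hGm : Measurable G := by fun_prop
  suffices h : ∫⁻ ω, ENNReal.ofReal (G (Y ω)) ∂P < ⊤ by
    refine ⟨(hGm.comp hY).aestronglyMeasurable, ?_⟩
    rw [hasFiniteIntegral_iff_ofReal (ae_of_all _ fun ω => (Real.exp_pos _).le)]
    exact h
  set δ := (C - s) / 2 with hδ
  have hδ0 : 0 < δ := by rw [hδ]; linarith
  obtain ⟨x₀, hx₀, hx₀0⟩ :=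
    ((eventually_forall_ge_atTop.2 (hf.eventually_bounds hδ0)).and (eventually_ge_atTop 0)).exists
  have hfin : IntegrableOn (weibull δ γ 0) (Set.Ioi 0) :=
    integrableOn_weibull hδ0 hγ (by norm_num)
  have hmap : ∫⁻ ω, ENNReal.ofReal (G (Y ω)) ∂P =
      ∫⁻ y, ENNReal.ofReal (f y) * ENNReal.ofReal (G y) := by
    rw [← lintegral_map (f := fun y => ENNReal.ofReal (G y)) hGm.ennreal_ofReal hY, hd.map_eq,
      lintegral_withDensity_eq_lintegral_mul _ hd.measurable.ennreal_ofReal hGm.ennreal_ofReal]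
    rfl
  have hpt : ∀ y, ENNReal.ofReal (f y) * ENNReal.ofReal (G y) ≤
      ENNReal.ofReal (f y) * ENNReal.ofReal (G x₀) +
        (Set.Ioi 0).indicator (fun y => ENNReal.ofReal (weibull δ γ 0 y)) y := by
    intro y
    rcases le_or_gt y x₀ with hy | hy
    · refine le_add_right ?_
      gcongr
      exact Real.exp_le_exp.2 (by gcongr)
    · refine le_add_left ?_
      have hy0 : 0 < y := hx₀0.trans_lt hy
      rw [Set.indicator_of_mem (Set.mem_Ioi.2 hy0), ← ENNReal.ofReal_mul (hd.nonneg y)]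
      apply ENNReal.ofReal_le_ofReal
      calc f y * G y ≤ Real.exp (-(C - δ) * y ^ γ) * Real.exp (s * y ^ γ) := by
            rw [hG]; simp only [max_eq_left hy0.le]
            gcongr; exact (hx₀ y hy.le).2
        _ = weibull δ γ 0 y := by
          rw [weibull, Real.rpow_zero, one_mul, ← Real.exp_add]
          congr 1; rw [hδ]; ring
  rw [hmap]
  refine (lintegral_mono hpt).trans_lt ?_
  rw [lintegral_add_left (by have := hd.measurable; fun_prop),
    lintegral_indicator measurableSet_Ioi,
    lintegral_mul_const' _ _ ENNReal.ofReal_ne_top]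
  refine ENNReal.add_lt_top.2 ⟨ENNReal.mul_lt_top ?_ ENNReal.ofReal_lt_top, ?_⟩
  · rw [← setLIntegral_univ, ← hd.measure_preimage hY MeasurableSet.univ]
    exact measure_lt_top _ _
  · exact (lintegral_mono fun y => Real.ofReal_le_enorm _).trans_lt hfin.2

/-- Chernoff bound for sums of positive parts, based on the subadditivity of `x ^ γ`. -/
lemma exists_tail_posPart_sum_le_exp [IsProbabilityMeasure P] (hε_meas : ∀ i, Measurable (ε i))
    (hind : iIndepFun ε P) (hd : ∀ i, HasDensity P (ε i) f) (hγ : 0 < γ) (hγ1 : γ < 1)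
    (hf : RoughWeibullTail f C γ) (S : Finset ι) {s : ℝ} (hs0 : 0 ≤ s) (hs : s < C) :
    ∃ c, 0 ≤ c ∧ ∀ t, 0 ≤ t →
      P.real {ω | t < ∑ k ∈ S, max (ε k ω) 0} ≤ c * Real.exp (-s * t ^ γ) := by
  set Z : ι → Ω → ℝ := fun k ω => (max (ε k ω) 0) ^ γ with hZ
  have hZm : ∀ k, Measurable (Z k) := fun k => by fun_prop
  have hZi : iIndepFun Z P := hind.comp (fun _ y => (max y 0) ^ γ) fun _ => by fun_prop
  have hint : Integrable (fun ω => Real.exp (s * (∑ k ∈ S, Z k) ω)) P :=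
    hZi.integrable_exp_mul_sum hZm fun k _ => (hd k).integrable_exp_mul_rpow (hε_meas k) hγ hf hs0 hs
  refine ⟨mgf (∑ k ∈ S, Z k) P s, mgf_nonneg, fun t ht => ?_⟩
  rw [mul_comm]
  refine le_trans (measureReal_mono fun ω hω => ?_)
    (measure_ge_le_exp_mul_mgf (t ^ γ) hs0 hint)
  have hω' : t < ∑ k ∈ S, max (ε k ω) 0 := hω
  change t ^ γ ≤ (∑ k ∈ S, Z k) ω
  rw [Finset.sum_apply]
  exact (Real.rpow_le_rpow ht hω'.le hγ.le).trans
    (rpow_sum_le_sum_rpow hγ hγ1.le S fun k => le_max_right _ _)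

lemma HasDensity.eventually_exp_le_tail {Y : Ω → ℝ} [IsFiniteMeasure P] (hd : HasDensity P Y f)
    (hY : Measurable Y) (hC : 0 < C) (hγ : 0 < γ) (hf : RoughWeibullTail f C γ) {δ : ℝ}
    (hδ : 0 < δ) :
    ∀ᶠ x in atTop, Real.exp (-(C + δ) * (x + 1) ^ γ) ≤ P.real {ω | x < Y ω} := by
  filter_upwards [eventually_forall_ge_atTop.2 (hf.eventually_bounds hδ), eventually_ge_atTop 0]
    with x hx hx0
  refine (ENNReal.ofReal_le_iff_le_toReal (measure_ne_top _ _)).1 ?_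
  change _ ≤ P (Y ⁻¹' Set.Ioi x)
  rw [hd.measure_preimage hY measurableSet_Ioi]
  calc ENNReal.ofReal (Real.exp (-(C + δ) * (x + 1) ^ γ))
      = ∫⁻ _ in Set.Ioc x (x + 1), ENNReal.ofReal (Real.exp (-(C + δ) * (x + 1) ^ γ)) := by
        rw [setLIntegral_const, Real.volume_Ioc]; simp
    _ ≤ ∫⁻ y in Set.Ioc x (x + 1), ENNReal.ofReal (f y) := by
        refine setLIntegral_mono' measurableSet_Ioc fun y hy => ENNReal.ofReal_le_ofReal ?_
        refine le_trans (Real.exp_le_exp.2 ?_) (hx y hy.1.le).1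
        have : y ^ γ ≤ (x + 1) ^ γ := Real.rpow_le_rpow (hx0.trans hy.1.le) hy.2 hγ.le
        nlinarith
    _ ≤ _ := lintegral_mono_set Set.Ioc_subset_Ioi_self

end Rough

end Sums

/-! ### From negligible events to conditional limits -/

section Conditioning

variable {Ω : Type*} [MeasurableSpace Ω] {P : Measure Ω}

lemma cond_real_eq {A B : Set Ω}
    (hB : MeasurableSet B) : (cond P B).real A = (P.real B)⁻¹ * P.real (B ∩ A) := by
  simp only [measureReal_def, cond_apply hB, ENNReal.toReal_mul, ENNReal.toReal_inv]

lemma tendsto_cond_zero [IsFiniteMeasure P] {A B : ℝ → Set Ω} (hB : ∀ x, MeasurableSet (B x))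
    (h : ∀ δ, 0 < δ → ∀ᶠ x in atTop, P.real (B x ∩ A x) ≤ δ * P.real (B x)) :
    Tendsto (fun x => cond P (B x) (A x)) atTop (𝓝 0) := by
  have h1 : Tendsto (fun x => (cond P (B x)).real (A x)) atTop (𝓝 0) := by
    refine Metric.tendsto_nhds.2 fun δ hδ => ?_
    filter_upwards [h (δ / 2) (half_pos hδ)] with x hx
    rw [Real.dist_0_eq_abs, abs_of_nonneg measureReal_nonneg, cond_real_eq (hB x)]
    rcases (measureReal_nonneg (μ := P) (s := B x)).eq_or_lt with h0 | h0
    · rw [← h0]; simpa using hδ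
    · rw [inv_mul_lt_iff₀ h0]
      nlinarith
  have := ENNReal.tendsto_ofReal h1
  simpa using this

lemma tendsto_cond_one [IsFiniteMeasure P] {A B : ℝ → Set Ω} (hB : ∀ x, MeasurableSet (B x))
    (hpos : ∀ᶠ x in atTop, 0 < P.real (B x))
    (h : ∀ δ, 0 < δ → ∀ᶠ x in atTop, P.real (B x \ A x) ≤ δ * P.real (B x)) :
    Tendsto (fun x => cond P (B x) (A x)) atTop (𝓝 1) := by
  have h1 : Tendsto (fun x => (cond P (B x)).real (A x)) atTop (𝓝 1) := by
    refine Metric.tendsto_nhds.2 fun δ hδ => ?_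
    filter_upwards [h (δ / 2) (half_pos hδ), hpos] with x hx h0
    have e1 : P.real (B x) ≤ P.real (B x ∩ A x) + P.real (B x \ A x) := by
      refine le_trans (measureReal_mono ?_) (measureReal_union_le _ _)
      rw [Set.inter_union_sdiff]
    have e2 : P.real (B x ∩ A x) ≤ P.real (B x) := measureReal_mono Set.inter_subset_left
    rw [Real.dist_eq, cond_real_eq (hB x), abs_lt]
    constructor
    · have : 1 - δ / 2 ≤ (P.real (B x))⁻¹ * P.real (B x ∩ A x) := by
        rw [le_inv_mul_iff₀ h0]; nlinarith
      linarith
    · have : (P.real (B x))⁻¹ * P.real (B x ∩ A x) ≤ 1 := by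
        rw [inv_mul_le_iff₀ h0]; linarith
      linarith
  have := ENNReal.tendsto_ofReal h1
  simpa using this

end Conditioning

/-! ### Moving averages with a single large variable -/

section MovingAverage

variable {Ω : Type*} {θ : ℤ → ℝ} {ε : ℤ → Ω → ℝ}

lemma movingAverage_eq_sum {J : Finset ℤ} {i : ℤ} (hJ : ∀ k, θ (k - i) ≠ 0 → k ∈ J) (ω : Ω) :
    movingAverage θ ε i ω = ∑ k ∈ J, θ (k - i) * ε k ω := by
  unfold movingAverage
  rw [← finsum_comp_equiv (Equiv.subRight i)]
  simp only [Equiv.subRight_apply, add_sub_cancel]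
  refine finsum_eq_sum_of_support_subset _ fun k hk => hJ k ?_
  exact left_ne_zero_of_mul hk

lemma movingAverage_zero_eq_sum {S : Finset ℤ} (hS : ∀ k, k ∈ S ↔ θ k ≠ 0) (ω : Ω) :
    movingAverage θ ε 0 ω = ∑ k ∈ S, θ k * ε k ω := by
  simpa using movingAverage_eq_sum (θ := θ) (ε := ε) (J := S) (i := 0)
    (fun k hk => (hS k).2 (by simpa using hk)) ω

lemma movingAverage_div (m : ℝ) (i : ℤ) (ω : Ω) :
    movingAverage (fun k => θ k / m) ε i ω = movingAverage θ ε i ω / m := by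
  unfold movingAverage
  rw [div_eq_inv_mul, mul_finsum]
  exact finsum_congr fun k => by ring

/-- The indices of the variables `ε k` that enter `X i` for some `|i| ≤ r`, when the weights
are supported in `S`. -/
noncomputable def inputIndices (S : Finset ℤ) (r : ℤ) : Finset ℤ :=
  (Finset.Icc (-r) r ×ˢ S).image fun p => p.2 + p.1

lemma mem_inputIndices {S : Finset ℤ} {r i k : ℤ} (hi : |i| ≤ r) (hk : k - i ∈ S) :
    k ∈ inputIndices S r := by
  refine Finset.mem_image.2 ⟨(i, k - i), ?_, sub_add_cancel k i⟩
  rw [Finset.mem_product, Finset.mem_Icc]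
  exact ⟨abs_le.1 hi, hk⟩

/-- The pointwise core of the cluster count. `T` is the set of indices of weight `1`, all other
weights being at most `ρ < 1`. The hypotheses `h1` to `h4` exclude four unlikely configurations:
a large `ε j` not needed for the exceedance, two large contributing variables, a variable far
beyond `x`, and a variable within a bounded distance of `x`. Then an exceedance of `X 0` is due to
a single large `ε j` with `j ∈ T`, and `X i > x` exactly when `j - i ∈ T`. -/
lemma exceedanceCount_eq_card (hθ0 : ∀ k, 0 ≤ θ k) {S T J : Finset ℤ} {r : ℤ}
    (hS : ∀ k, k ∈ S ↔ θ k ≠ 0) (hr : ∀ k l : ℤ, θ k ≠ 0 → θ l ≠ 0 → l - k ≤ r)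
    (hr0 : 0 ≤ r) (hJ : J = inputIndices S r)
    (hT : ∀ k ∈ T, θ k = 1) {ρ η : ℝ} (hρ0 : 0 ≤ ρ) (hρ1 : ρ < 1) (hρ : ∀ k, k ∉ T → θ k ≤ ρ)
    {x K : ℝ} (hK : 0 ≤ K) (hx : J.card * K ≤ x * (1 - ρ * η)) (hxK : J.card * K < x) {ω : Ω}
    (hω : x < movingAverage θ ε 0 ω)
    (h1 : ∀ j ∈ J, ¬ (K < |ε j ω| ∧ x < ∑ k ∈ S.erase j, max (ε k ω) 0))
    (h2 : ∀ j ∈ S, ¬ (K < ε j ω ∧ K < ∑ k ∈ S.erase j, max (ε k ω) 0 ∧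
        x < ε j ω + ∑ k ∈ S.erase j, max (ε k ω) 0))
    (h3 : ∀ j ∈ S, ¬ η * x < ε j ω)
    (h4 : ∀ j ∈ S, ¬ (x - J.card * K < ε j ω ∧ ε j ω ≤ x + J.card * K)) :
    exceedanceCount (movingAverage θ ε) r x ω = T.card := by
  have hθ1 : ∀ k, θ k ≤ 1 := fun k => by
    by_cases hk : k ∈ T
    · exact (hT k hk).le
    · exact (hρ k hk).trans hρ1.le
  have hTS : ∀ k ∈ T, k ∈ S := fun k hk => (hS k).2 (by rw [hT k hk]; exact one_ne_zero)
  have hSJ : S ⊆ J := fun k hk => hJ ▸ mem_inputIndices (i := 0) (by simpa using hr0) (by simpa using hk)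
  have hX : ∀ i, |i| ≤ r → movingAverage θ ε i ω = ∑ k ∈ J, θ (k - i) * ε k ω := fun i hi =>
    movingAverage_eq_sum (fun k hk => hJ ▸ mem_inputIndices hi ((hS _).2 hk)) ω
  have hle : ∀ k, θ k * ε k ω ≤ max (ε k ω) 0 := fun k => by
    rcases le_total 0 (ε k ω) with h | h
    · rw [max_eq_left h]; exact mul_le_of_le_one_left h (hθ1 k)
    · rw [max_eq_right h]; exact mul_nonpos_of_nonneg_of_nonpos (hθ0 k) h
  have hpos : x < ∑ k ∈ S, max (ε k ω) 0 :=
    (movingAverage_zero_eq_sum hS ω ▸ hω).trans_le (Finset.sum_le_sum fun k _ => hle k)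
  -- some variable exceeds the threshold
  obtain ⟨j, hjS, hjK⟩ : ∃ j ∈ S, K < ε j ω := by
    by_contra! hcon
    have e1 : ∑ k ∈ S, max (ε k ω) 0 ≤ S.card * K := by
      rw [← nsmul_eq_mul]
      exact Finset.sum_le_card_nsmul _ _ _ fun k hk => max_le (hcon k hk) hK
    have e2 : (S.card : ℝ) * K ≤ J.card * K := by
      gcongr
    linarith
  have hjpos : max (ε j ω) 0 = ε j ω := max_eq_left (hK.trans hjK.le)
  -- and it is the only one
  have hsmall : ∀ k ∈ J, k ≠ j → |ε k ω| ≤ K := by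
    intro k hkJ hkj
    by_contra! hk
    by_cases hkS : k ∈ S
    · rcases le_or_gt 0 (ε k ω) with hk0 | hk0
      · rw [abs_of_nonneg hk0] at hk
        refine h2 j hjS ⟨hjK, ?_, ?_⟩
        · refine hk.trans_le ((le_max_left _ 0).trans ?_)
          exact Finset.single_le_sum (f := fun k => max (ε k ω) 0) (fun _ _ => le_max_right _ _)
            (Finset.mem_erase.2 ⟨hkj, hkS⟩)
        · rw [← Finset.add_sum_erase _ _ hjS, hjpos] at hpos
          exact hpos
      · refine h1 k hkJ ⟨hk, ?_⟩
        rw [← Finset.add_sum_erase _ _ hkS, max_eq_right hk0.le, zero_add] at hpos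
        exact hpos
    · refine h1 k hkJ ⟨hk, ?_⟩
      rwa [Finset.erase_eq_of_notMem hkS]
  have hrest : ∀ i, |i| ≤ r →
      |movingAverage θ ε i ω - θ (j - i) * ε j ω| ≤ J.card * K := by
    intro i hi
    rw [hX i hi, ← Finset.add_sum_erase _ _ (hSJ hjS), add_sub_cancel_left]
    refine (Finset.abs_sum_le_sum_abs _ _).trans ?_
    have e1 : ∑ k ∈ J.erase j, |θ (k - i) * ε k ω| ≤ (J.erase j).card * K := by
      rw [← nsmul_eq_mul]
      refine Finset.sum_le_card_nsmul _ _ _ fun k hk => ?_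
      rw [abs_mul, abs_of_nonneg (hθ0 _)]
      have := hsmall k (Finset.mem_of_mem_erase hk) (Finset.ne_of_mem_erase hk)
      calc θ (k - i) * |ε k ω| ≤ 1 * K :=
            mul_le_mul (hθ1 _) this (abs_nonneg _) zero_le_one
        _ = K := one_mul K
    refine e1.trans ?_
    gcongr
    exact Finset.erase_subset _ _
  have hjη : ε j ω ≤ η * x := not_lt.1 (h3 j hjS)
  have hnot : ∀ i, |i| ≤ r → j - i ∉ T → movingAverage θ ε i ω ≤ x := by
    intro i hi hji
    have e1 := (abs_le.1 (hrest i hi)).2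
    have e2 : θ (j - i) * ε j ω ≤ ρ * (η * x) :=
      mul_le_mul (hρ _ hji) hjη (hK.trans hjK.le) hρ0
    linarith
  have hr0' : |(0 : ℤ)| ≤ r := by simpa using hr0
  have hjT : j ∈ T := by
    by_contra hj
    exact absurd hω (not_lt.2 (hnot 0 hr0' (by simpa using hj)))
  have hbig : x + J.card * K < ε j ω := by
    by_contra! hcon
    refine h4 j hjS ⟨?_, hcon⟩
    have e1 := (abs_le.1 (hrest 0 hr0')).2
    rw [sub_zero, hT j hjT, one_mul] at e1
    linarith
  have hiff : ∀ i, |i| ≤ r → (x < movingAverage θ ε i ω ↔ j - i ∈ T) := by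
    intro i hi
    constructor
    · intro h
      by_contra hcon
      exact absurd h (not_lt.2 (hnot i hi hcon))
    · intro h
      have e1 := (abs_le.1 (hrest i hi)).1
      rw [hT _ h, one_mul] at e1
      linarith
  unfold exceedanceCount
  refine Finset.card_bij' (fun i _ => j - i) (fun t _ => j - t) ?_ ?_ ?_ ?_
  · intro i hi
    rw [Finset.mem_filter, Finset.mem_Icc] at hi
    exact (hiff i (abs_le.2 hi.1)).1 hi.2
  · intro t ht
    have e1 := hr t j ((hS t).1 (hTS t ht)) ((hS j).1 hjS)
    have e2 := hr j t ((hS j).1 hjS) ((hS t).1 (hTS t ht))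
    have e3 : |j - t| ≤ r := abs_le.2 ⟨by linarith, e1⟩
    rw [Finset.mem_filter, Finset.mem_Icc]
    exact ⟨abs_le.1 e3, (hiff _ e3).2 (by rwa [sub_sub_cancel])⟩
  · intro i _; exact sub_sub_cancel j i
  · intro t _; exact sub_sub_cancel j t

end MovingAverage

/-! ### Exceedances of the moving average -/

section Clustering

variable {Ω : Type*} [MeasurableSpace Ω] {P : Measure Ω} [IsProbabilityMeasure P]
  {ε : ℤ → Ω → ℝ} {f : ℝ → ℝ} {θ : ℤ → ℝ} {γ C C₁ C₂ : ℝ}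

lemma measurable_movingAverage (hε_meas : ∀ i, Measurable (ε i)) {S : Finset ℤ}
    (hS : ∀ k, k ∈ S ↔ θ k ≠ 0) (i : ℤ) : Measurable (movingAverage θ ε i) := by
  have : movingAverage θ ε i = fun ω => ∑ k ∈ inputIndices S |i|, θ (k - i) * ε k ω := by
    ext ω
    exact movingAverage_eq_sum (fun k hk => mem_inputIndices le_rfl ((hS _).2 hk)) ω
  rw [this]
  fun_prop

/-- Absence of clustering for weights whose maximum is normalized to `1` and attained only at `l`.
An exceedance by both `X 0` and `X i` makes the average `(X 0 + X i) / 2`, whose coefficients are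
bounded by some `w < 1`, exceed `x`; this costs a strictly larger exponent than `X 0 > x`. -/
lemma noClustering_of_unique_max (hε_meas : ∀ i, Measurable (ε i)) (hind : iIndepFun ε P)
    (hd : ∀ i, HasDensity P (ε i) f) (hθ0 : ∀ k, 0 ≤ θ k) {S : Finset ℤ}
    (hS : ∀ k, k ∈ S ↔ θ k ≠ 0) {l : ℤ} (hl : θ l = 1) {ρ : ℝ} (hρ0 : 0 ≤ ρ) (hρ1 : ρ < 1)
    (hρ : ∀ k, k ≠ l → θ k ≤ ρ) (hγ : 0 < γ) (hγ1 : γ < 1) (hC : 0 < C)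
    (hf : RoughWeibullTail f C γ) : NoClustering P (movingAverage θ ε) := by
  intro i₀ _
  have hθ1 : ∀ k, θ k ≤ 1 := fun k => by
    by_cases hk : k = l
    · rw [hk, hl]
    · exact (hρ k hk).trans hρ1.le
  refine tendsto_cond_zero (B := fun x => {ω | x < movingAverage θ ε 0 ω})
    (A := fun x => {ω | ∃ i : ℤ, 1 ≤ |i| ∧ |i| ≤ (i₀ : ℤ) ∧ x < movingAverage θ ε i ω})
    (fun x => measurableSet_lt measurable_const (measurable_movingAverage hε_meas hS 0)) ?_
  intro δ hδ
  set w := (1 + ρ) / 2 with hw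
  have hw0 : 0 < w := by rw [hw]; linarith
  have hw1 : w < 1 := by rw [hw]; linarith
  set J := inputIndices S i₀ with hJ
  -- averaging the two exceedances: the coefficients of `X 0 + X i` stay below `2 * w < 2`
  have hsub : ∀ x, 0 ≤ x → {ω | x < movingAverage θ ε 0 ω} ∩
      {ω | ∃ i : ℤ, 1 ≤ |i| ∧ |i| ≤ (i₀ : ℤ) ∧ x < movingAverage θ ε i ω} ⊆
      {ω | x * w⁻¹ < ∑ k ∈ J, max (ε k ω) 0} := by
    rintro x hx ω ⟨e0, i, hi1, hi2, e1⟩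
    have e0' : x < movingAverage θ ε 0 ω := e0
    rw [movingAverage_eq_sum (J := J) (i := 0)
      (fun k hk => mem_inputIndices (by simp) ((hS _).2 hk))] at e0'
    rw [movingAverage_eq_sum (J := J) (fun k hk => mem_inputIndices hi2 ((hS _).2 hk))] at e1
    have hi0 : i ≠ 0 := by rintro rfl; simp at hi1
    have e2 : ∑ k ∈ J, θ (k - 0) * ε k ω + ∑ k ∈ J, θ (k - i) * ε k ω ≤
        2 * w * ∑ k ∈ J, max (ε k ω) 0 := by
      rw [← Finset.sum_add_distrib, Finset.mul_sum]
      refine Finset.sum_le_sum fun k _ => ?_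
      have hcoef : θ k + θ (k - i) ≤ 2 * w := by
        by_cases hk : k = l
        · have := hρ (k - i) (by rw [hk]; simpa using hi0)
          have := hθ1 k
          rw [hw]; linarith
        · have := hρ k hk
          have := hθ1 (k - i)
          rw [hw]; linarith
      rw [sub_zero, ← add_mul]
      calc (θ k + θ (k - i)) * ε k ω ≤ (θ k + θ (k - i)) * max (ε k ω) 0 := by
            gcongr
            · exact add_nonneg (hθ0 _) (hθ0 _)
            · exact le_max_left _ _
        _ ≤ _ := by
            gcongr
    change x * w⁻¹ < ∑ k ∈ J, max (ε k ω) 0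
    rw [← div_eq_mul_inv, div_lt_iff₀ hw0]
    linarith
  -- `v > 1` is the gain in the exponent
  set v := (w⁻¹) ^ γ with hv
  have hv1 : 1 < v := Real.one_lt_rpow ((one_lt_inv₀ hw0).2 hw1) hγ
  obtain ⟨s, hs1, hs2⟩ : ∃ s, C / v < s ∧ s < C := exists_between (div_lt_self hC hv1)
  have hv0 : 0 < v := by linarith
  have hs0 : 0 < s := (div_pos hC hv0).trans hs1
  set τ := (s * v - C) / 2 with hτ
  have hτ0 : 0 < τ := by
    rw [div_lt_iff₀ hv0] at hs1
    rw [hτ]; linarith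
  obtain ⟨c, hc, hup⟩ := exists_tail_posPart_sum_le_exp hε_meas hind hd hγ hγ1 hf J hs0.le hs2
  obtain ⟨K, hK, hlow⟩ := exists_tail_sum_ge hε_meas hind
    ((hS l).2 (by rw [hl]; exact one_ne_zero)) hl
  set D := 1 / 2 * Real.exp (-(C + τ) * (K + 1) ^ γ) with hD
  have hD0 : 0 < D := by positivity
  have hlim : Tendsto (fun x : ℝ => c * Real.exp (-τ * x ^ γ)) atTop (𝓝 (c * 0)) := by
    refine Tendsto.const_mul _ (Real.tendsto_exp_atBot.comp ?_)
    exact (tendsto_rpow_atTop hγ).const_mul_atTop_of_neg (by linarith)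
  rw [mul_zero] at hlim
  filter_upwards [hlim.eventually_le_const (show 0 < δ * D by positivity), eventually_ge_atTop 0,
    (tendsto_atTop_add_const_right _ K tendsto_id).eventually
      ((hd l).eventually_exp_le_tail (hε_meas l) hC hγ hf hτ0)] with x hx hx0 hxl
  have hB : D * Real.exp (-(C + τ) * x ^ γ) ≤ P.real {ω | x < movingAverage θ ε 0 ω} := by
    simp only [movingAverage_zero_eq_sum hS]
    refine le_trans ?_ (hlow x)
    rw [hD, mul_assoc]
    refine mul_le_mul_of_nonneg_left (le_trans ?_ hxl) (by norm_num)
    rw [← Real.exp_add]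
    apply Real.exp_le_exp.2
    have h1 : (id x + K + 1) ^ γ ≤ x ^ γ + (K + 1) ^ γ := by
      rw [id, add_assoc]
      exact Real.rpow_add_le_add_rpow hx0 (by linarith) hγ.le hγ1.le
    nlinarith
  calc P.real _ ≤ P.real {ω | x * w⁻¹ < ∑ k ∈ J, max (ε k ω) 0} := measureReal_mono (hsub x hx0)
    _ ≤ c * Real.exp (-s * (x * w⁻¹) ^ γ) := hup _ (by positivity)
    _ = c * Real.exp (-τ * x ^ γ) * Real.exp (-(C + τ) * x ^ γ) := by
      rw [Real.mul_rpow hx0 (by positivity), ← hv, mul_assoc, ← Real.exp_add]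
      congr 2
      rw [hτ]; ring
    _ ≤ δ * D * Real.exp (-(C + τ) * x ^ γ) := by gcongr
    _ = δ * (D * Real.exp (-(C + τ) * x ^ γ)) := by ring
    _ ≤ _ := by gcongr

/-- The cluster size for weights whose maximum is normalized to `1` and attained exactly on `T`:
each configuration excluded in `exceedanceCount_eq_card` has a probability negligible with respect
to the Weibull tail, which `P (X 0 > x)` dominates. -/
lemma tendsto_cond_exceedanceCount (hε_meas : ∀ i, Measurable (ε i)) (hind : iIndepFun ε P)
    (hd : ∀ i, HasDensity P (ε i) f) (hθ0 : ∀ k, 0 ≤ θ k) {S T : Finset ℤ}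
    (hS : ∀ k, k ∈ S ↔ θ k ≠ 0) (hT : ∀ k ∈ T, θ k = 1) (hTne : T.Nonempty) {ρ : ℝ}
    (hρ0 : 0 < ρ) (hρ1 : ρ < 1) (hρ : ∀ k, k ∉ T → θ k ≤ ρ) {r : ℤ}
    (hr : ∀ k l : ℤ, θ k ≠ 0 → θ l ≠ 0 → l - k ≤ r)
    (hγ : 0 < γ) (hγ1 : γ < 1) (hC : 0 < C) (hC₁ : 0 < C₁) (hC₂ : 0 ≤ C₂)
    (hf : ExactWeibullTail f C C₁ C₂ γ) :
    Tendsto (fun x : ℝ => cond P {ω | x < movingAverage θ ε 0 ω}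
      {ω | exceedanceCount (movingAverage θ ε) r x ω = T.card}) atTop (𝓝 1) := by
  have ha : 0 ≤ C₂ + 1 - γ := by linarith
  obtain ⟨l, hlT⟩ := hTne
  have hl : θ l = 1 := hT l hlT
  have hlS : l ∈ S := (hS l).2 (by rw [hl]; exact one_ne_zero)
  have hr0 : 0 ≤ r := by simpa using hr l l ((hS l).1 hlS) ((hS l).1 hlS)
  -- the conditioning event is at least of the order of the Weibull tail
  obtain ⟨L, hL, hlow⟩ := exists_tail_sum_ge hε_meas hind hlS hl
  obtain ⟨c, hc, hcl⟩ := (hd l).le_tail (hε_meas l) hC hC₁ hC₂ hγ hγ1 hf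
  set D := 1 / 2 * c * (Real.exp (C * L ^ γ))⁻¹ with hD
  have hD0 : 0 < D := by positivity
  have hB : ∀ᶠ x in atTop, D * weibull C γ (C₂ + 1 - γ) x ≤
      P.real {ω | x < movingAverage θ ε 0 ω} := by
    filter_upwards [(tendsto_atTop_add_const_right _ L tendsto_id).eventually hcl,
      eventually_ge_atTop 0] with x hx hx0
    simp only [movingAverage_zero_eq_sum hS]
    refine le_trans ?_ (hlow x)
    have h1 := weibull_le_exp_mul_weibull_add hC.le hγ.le hγ1.le ha hx0 hL
    rw [hD, mul_assoc, mul_assoc]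
    refine mul_le_mul_of_nonneg_left (le_trans ?_ hx) (by norm_num)
    refine mul_le_mul_of_nonneg_left ?_ hc.le
    rwa [inv_mul_le_iff₀ (Real.exp_pos _)]
  refine tendsto_cond_one (B := fun x => {ω | x < movingAverage θ ε 0 ω})
    (fun x => measurableSet_lt measurable_const (measurable_movingAverage hε_meas hS 0)) ?_ ?_
  · filter_upwards [hB, eventually_gt_atTop 0] with x hx hx0
    exact (mul_pos hD0 (weibull_pos hx0)).trans_le hx
  intro δ hδ
  set J := inputIndices S r with hJ
  have hSJ : S ⊆ J := fun k hk => mem_inputIndices (i := 0) (by simpa using hr0) (by simpa using hk)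
  set τ := δ * D / (4 * (J.card + 1)) with hτ
  have hτ0 : 0 < τ := by positivity
  obtain ⟨η, hη1, hη2⟩ : ∃ η, 1 < η ∧ η < ρ⁻¹ := exists_between ((one_lt_inv₀ hρ0).2 hρ1)
  have hρη : 0 < 1 - ρ * η := by
    have := mul_lt_mul_of_pos_left hη2 hρ0
    rw [mul_inv_cancel₀ hρ0.ne'] at this
    linarith
  -- fix the threshold separating large from moderate values
  obtain ⟨K, hK0, hK1, hK2⟩ := ((eventually_gt_atTop (0 : ℝ)).and
    (((Finset.eventually_all J).2 fun j _ => eventually_large_outside_le hε_meas hind hd hC hC₁ hC₂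
      hγ hγ1 hf (Finset.notMem_erase j S) hτ0).and
    ((Finset.eventually_all S).2 fun j _ => eventually_two_large_le hε_meas hind hd hC hC₁ hC₂
      hγ hγ1 hf (Finset.notMem_erase j S) hτ0))).exists
  have hJ1 : 0 < (J.card : ℝ) := by exact_mod_cast Finset.card_pos.2 ⟨l, hSJ hlS⟩
  have hK3 : ∀ j ∈ S, ∀ᶠ x in atTop, P.real {ω | η * x < ε j ω} ≤
      τ * weibull C γ (C₂ + 1 - γ) x := by
    intro j _
    obtain ⟨c', hc', hcu⟩ := (hd j).tail_le (hε_meas j) hC hC₁ hC₂ hγ hγ1 hf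
    filter_upwards [(tendsto_id.const_mul_atTop (show 0 < η by linarith)).eventually hcu,
      eventually_weibull_mul_le (a := C₂ + 1 - γ) hC hγ hη1 (show 0 < τ / c' by positivity)]
      with x h1 h2
    calc _ ≤ c' * weibull C γ (C₂ + 1 - γ) (η * x) := h1
      _ ≤ c' * (τ / c' * weibull C γ (C₂ + 1 - γ) x) := by gcongr
      _ = _ := by field_simp
  have hK4 : ∀ j ∈ S, ∀ᶠ x in atTop,
      P.real {ω | x - J.card * K < ε j ω ∧ ε j ω ≤ x + J.card * K} ≤
        τ * weibull C γ (C₂ + 1 - γ) x := fun j _ =>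
    (hd j).eventually_window_le (hε_meas j) hC hC₁ hC₂ hγ hγ1 hf (mul_pos hJ1 hK0) hτ0
  filter_upwards [(Finset.eventually_all J).2 hK1, (Finset.eventually_all S).2 hK2,
    (Finset.eventually_all S).2 hK3, (Finset.eventually_all S).2 hK4, hB, eventually_gt_atTop 0,
    eventually_gt_atTop (J.card * K), eventually_ge_atTop (J.card * K / (1 - ρ * η))]
    with x b1 b2 b3 b4 hBx hx0 hx1 hx2
  rw [div_le_iff₀ hρη] at hx2
  have hW := weibull_nonneg (C := C) (γ := γ) (a := C₂ + 1 - γ) hx0.le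
  set E1 := ⋃ j ∈ J, {ω | K < |ε j ω| ∧ x < ∑ k ∈ S.erase j, max (ε k ω) 0} with hE1
  set E2 := ⋃ j ∈ S, {ω | K < ε j ω ∧ K < ∑ k ∈ S.erase j, max (ε k ω) 0 ∧
    x < ε j ω + ∑ k ∈ S.erase j, max (ε k ω) 0} with hE2
  set E3 := ⋃ j ∈ S, {ω | η * x < ε j ω} with hE3
  set E4 := ⋃ j ∈ S, {ω | x - J.card * K < ε j ω ∧ ε j ω ≤ x + J.card * K} with hE4
  have hsub : {ω | x < movingAverage θ ε 0 ω} \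
      {ω | exceedanceCount (movingAverage θ ε) r x ω = T.card} ⊆ E1 ∪ E2 ∪ (E3 ∪ E4) := by
    rintro ω ⟨h0, hne⟩
    by_contra hcon
    simp only [hE1, hE2, hE3, hE4, Set.mem_union, Set.mem_iUnion, Set.mem_ofPred_eq, not_or,
      not_exists] at hcon
    exact hne (exceedanceCount_eq_card hθ0 hS hr hr0 hJ hT hρ0.le hρ1 hρ hK0.le hx2 hx1 h0
      hcon.1.1 hcon.1.2 hcon.2.1 hcon.2.2)
  have hun : ∀ (U : Finset ℤ) (E : ℤ → Set Ω), U ⊆ J →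
      (∀ j ∈ U, P.real (E j) ≤ τ * weibull C γ (C₂ + 1 - γ) x) →
      P.real (⋃ j ∈ U, E j) ≤ J.card * (τ * weibull C γ (C₂ + 1 - γ) x) := by
    intro U E hU hE
    refine (measureReal_biUnion_finset_le U E).trans ?_
    refine (Finset.sum_le_card_nsmul _ _ _ hE).trans ?_
    rw [nsmul_eq_mul]
    gcongr
  have f1 := hun J _ subset_rfl b1
  have f2 := hun S _ hSJ b2
  have f3 := hun S _ hSJ b3
  have f4 := hun S _ hSJ b4
  have g1 := measureReal_union_le (μ := P) E1 E2
  have g2 := measureReal_union_le (μ := P) E3 E4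
  have g3 := measureReal_union_le (μ := P) (E1 ∪ E2) (E3 ∪ E4)
  have hτ' : 4 * (J.card * (τ * weibull C γ (C₂ + 1 - γ) x)) ≤
      δ * (D * weibull C γ (C₂ + 1 - γ) x) := by
    have e : 4 * (J.card * τ) ≤ δ * D := by
      rw [hτ, ← mul_assoc, ← mul_div_assoc, div_le_iff₀ (by positivity)]
      have : 0 ≤ δ * D := by positivity
      nlinarith
    nlinarith [mul_le_mul_of_nonneg_right e hW]
  calc _ ≤ P.real (E1 ∪ E2 ∪ (E3 ∪ E4)) := measureReal_mono hsub
    _ ≤ 4 * (J.card * (τ * weibull C γ (C₂ + 1 - γ) x)) := by linarith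
    _ ≤ δ * (D * weibull C γ (C₂ + 1 - γ) x) := hτ'
    _ ≤ _ := by gcongr

/-- As the support is finite, the weights that are not maximal stay away from the maximum `1`. -/
lemma exists_lt_one_of_notMem_maximizers (hfin : (Function.support θ).Finite)
    {l : ℤ} (hl : ∀ k, θ k ≤ θ l) (hl1 : θ l = 1) :
    ∃ ρ, 0 < ρ ∧ ρ < 1 ∧ ∀ k, k ∉ maximizers θ → θ k ≤ ρ := by
  classical
  set U : Finset ℝ := insert (1 / 2) ((hfin.toFinset.filter (· ∉ maximizers θ)).image θ) with hU
  have hne : U.Nonempty := Finset.insert_nonempty _ _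
  have hhalf : 1 / 2 ≤ U.max' hne := U.le_max' _ (Finset.mem_insert_self _ _)
  refine ⟨U.max' hne, by linarith, ?_, ?_⟩
  · rw [Finset.max'_lt_iff]
    intro y hy
    rcases Finset.mem_insert.1 hy with rfl | hy
    · norm_num
    · obtain ⟨k, hk, rfl⟩ := Finset.mem_image.1 hy
      have hk' := (Finset.mem_filter.1 hk).2
      refine lt_of_le_of_ne (hl1 ▸ hl k) fun h => hk' fun m => ?_
      rw [h, ← hl1]; exact hl m
  · intro k hk
    by_cases h0 : θ k = 0
    · rw [h0]; linarith
    · exact U.le_max' _ (Finset.mem_insert_of_mem (Finset.mem_image_of_mem _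
        (Finset.mem_filter.2 ⟨hfin.mem_toFinset.2 h0, hk⟩)))

end Clustering

theorem theorem3p4 {Ω : Type*} [MeasurableSpace Ω] (P : Measure Ω) [IsProbabilityMeasure P]
    (ε : ℤ → Ω → ℝ) (hε_meas : ∀ i, Measurable (ε i)) (hε_indep : iIndepFun ε P)
    (f : ℝ → ℝ) (hε_density : ∀ i, HasDensity P (ε i) f)
    (θ : ℤ → ℝ) (hθ_nonneg : ∀ k, 0 ≤ θ k) (hθ_finite : (Function.support θ).Finite)
    (hθ_ne : ∃ k, θ k ≠ 0)
    (γ : ℝ) (hγ_pos : 0 < γ) (hγ_lt : γ < 1) :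
    (∀ C : ℝ, 0 < C → RoughWeibullTail f C γ →
      (maximizers θ).ncard = 1 →
      NoClustering P (movingAverage θ ε)) ∧
    (∀ C C₁ C₂ : ℝ, 0 < C → 0 < C₁ → 0 ≤ C₂ → ExactWeibullTail f C C₁ C₂ γ →
      ∀ q : ℕ, 2 ≤ q → (maximizers θ).ncard = q →
      ∀ r : ℤ, (∀ k l : ℤ, θ k ≠ 0 → θ l ≠ 0 → l - k ≤ r) →
      Tendsto (fun x : ℝ =>
        cond P {ω | x < movingAverage θ ε 0 ω}
          {ω | exceedanceCount (movingAverage θ ε) r x ω = q})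
        atTop (𝓝 1)) := by
  -- dividing weights and level by the largest weight reduces to weights with maximum `1`
  have norm : ∀ l ∈ maximizers θ, ∃ m, 0 < m ∧ θ l / m = 1 ∧
      (Function.support fun k => θ k / m).Finite ∧
      maximizers (fun k => θ k / m) = maximizers θ ∧ (∀ k, 0 ≤ θ k / m) ∧
      (∀ k, θ k / m ≠ 0 ↔ θ k ≠ 0) ∧
      ∀ i ω x, x / m < movingAverage (fun k => θ k / m) ε i ω ↔ x < movingAverage θ ε i ω := by
    intro l hl
    obtain ⟨k₀, hk₀⟩ := hθ_ne
    have hm : 0 < θ l := (lt_of_le_of_ne (hθ_nonneg k₀) hk₀.symm).trans_le (hl k₀)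
    have hne : ∀ k, θ k / θ l ≠ 0 ↔ θ k ≠ 0 := fun k => by simp [hm.ne']
    refine ⟨θ l, hm, div_self hm.ne', hθ_finite.subset fun k hk => (hne k).1 hk, ?_,
      fun k => div_nonneg (hθ_nonneg k) hm.le, hne, fun i ω x => ?_⟩
    · ext j
      exact forall_congr' fun k => div_le_div_iff_of_pos_right hm
    · rw [movingAverage_div, div_lt_div_iff_of_pos_right hm]
  constructor
  · intro C hC hf hcard
    obtain ⟨l, hl⟩ := Set.ncard_eq_one.1 hcard
    obtain ⟨m, hm, hl1, hfin, hmax, hnn, hne, hiff⟩ := norm l (by rw [hl]; rfl)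
    have hlmax : l ∈ maximizers (fun k => θ k / m) := by rw [hmax, hl]; rfl
    obtain ⟨ρ, hρ0, hρ1, hρ⟩ := exists_lt_one_of_notMem_maximizers hfin hlmax hl1
    rw [hmax, hl] at hρ
    have key := noClustering_of_unique_max hε_meas hε_indep hε_density hnn
      (S := hfin.toFinset) (fun k => by simp) hl1 hρ0.le hρ1 hρ hγ_pos hγ_lt hC hf
    intro i₀ hi₀
    have := (key i₀ hi₀).comp (tendsto_id.atTop_div_const hm)
    simpa only [Function.comp_def, id, hiff] using this
  · intro C C₁ C₂ hC hC₁ hC₂ hf q hq hcard r hr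
    have hfinmax : (maximizers θ).Finite := Set.finite_of_ncard_pos (by omega)
    obtain ⟨l, hl⟩ : (maximizers θ).Nonempty := Set.nonempty_of_ncard_ne_zero (by omega)
    obtain ⟨m, hm, hl1, hfin, hmax, hnn, hne, hiff⟩ := norm l hl
    have hlmax : l ∈ maximizers (fun k => θ k / m) := by rw [hmax]; exact hl
    obtain ⟨ρ, hρ0, hρ1, hρ⟩ := exists_lt_one_of_notMem_maximizers hfin hlmax hl1
    have hq' : hfinmax.toFinset.card = q := by
      rw [← hcard, Set.ncard_eq_toFinset_card _ hfinmax]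
    have key := tendsto_cond_exceedanceCount hε_meas hε_indep hε_density hnn
      (S := hfin.toFinset) (T := hfinmax.toFinset) (fun k => by simp)
      (fun k hk => le_antisymm (hl1 ▸ hlmax k)
        (hl1 ▸ (hmax ▸ (hfinmax.mem_toFinset.1 hk) : k ∈ maximizers fun k => θ k / m) l))
      ⟨l, hfinmax.mem_toFinset.2 hl⟩ hρ0 hρ1
      (fun k hk => hρ k (by rw [hmax]; simpa using hk)) (r := r)
      (fun k l hk hl' => hr k l ((hne k).1 hk) ((hne l).1 hl'))
      hγ_pos hγ_lt hC hC₁ hC₂ hf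
    have := key.comp (tendsto_id.atTop_div_const hm)
    simpa only [Function.comp_def, id, hiff, exceedanceCount, hq'] using this
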